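/- Let $\beta,\gamma,c>0$ and put $$\xi_0=e^{-\beta\gamma(1-e^{-\gamma})},\qquad \sigma=\frac{1-e^{-c}}{1-\xi_0},\qquad \tilde\gamma=\frac{(\sigma+e^{-c})\gamma}{\sigma}.$$ For $M\in\mathbb N$ let $n^{\mathrm{RIG}}=\lfloor\sigma M\rfloor$, $n_0=\lfloor e^{-c}M\rfloor$ and $n=n^{\mathrm{RIG}}+n_0$. Consider the graph consisting of (a) a random intersection graph on $n^{\mathrm{RIG}}$ vertices: each vertex is connected to each of $\lfloor\beta n^{\mathrm{RIG}}\rfloor$ attributes independently with probability $\gamma/n^{\mathrm{RIG}}$ (for $n^{\mathrm{RIG}}\ge\gamma$), and two distinct vertices are neighbours if they share an attribute; and (b) $n_0$ additional isolated vertices. The graph is explored as follows. Initially all vertices are unaffected. In each iteration $t=1,\dots,n$, a vertex is selected uniformly at random from the currently unaffected vertices and becomes excited, and its unaffected neighbours become blocked; if there is no unaffected vertex, nothing changes. Let $U(t)$ and $X(t)$ be the numbers of unaffected and of excited vertices after $t$ iterations. Let $\tilde u,\tilde w$ be the continuous solution on $[0,1]$ of $$\tilde u(s)=1-s-\int_0^s\gamma^2\tilde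 u(y)\tilde w(y)\,dy,\qquad \tilde w(s)=\beta-\int_0^s\gamma\tilde w(y)\,dy,$$ and let $$\phi=\frac{e^{-c}+\sigma\inf\{s\in[0,1]:\tilde u(s)=0\}}{e^{-c}+\sigma}.$$ Then $0<\phi\le1$, and there are functions $u^{\mathrm{RIG}},u_0^{\mathrm{DRIG}},w^{\mathrm{RIG}},x_0^{\mathrm{RIG}},x_{1+}^{\mathrm{RIG}},x_0^{\mathrm{DRIG}}$ on $[0,\phi)$, continuous and with $u^{\mathrm{RIG}}+u_0^{\mathrm{DRIG}}>0$, that satisfy for $0\le s<\phi$ $$\begin{aligned} u^{\mathrm{RIG}}(s)&=\frac{\sigma}{\sigma+e^{-c}}-\int_0^s\frac{u^{\mathrm{RIG}}}{u^{\mathrm{RIG}}+u_0^{\mathrm{DRIG}}}\bigl(1+\tilde\gamma^2u^{\mathrm{RIG}}w^{\mathrm{RIG}}\bigr)\,dy,\\ u_0^{\mathrm{DRIG}}(s)&=\frac{e^{-c}}{\sigma+e^{-c}}-\int_0^s\frac{u_0^{\mathrm{DRIG}}}{u^{\mathrm{RIG}}+u_0^{\mathrm{DRIG}}}\,dy,\\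 w^{\mathrm{RIG}}(s)&=\frac{\beta\sigma}{\sigma+e^{-c}}-\int_0^s\frac{u^{\mathrm{RIG}}}{u^{\mathrm{RIG}}+u_0^{\mathrm{DRIG}}}\,\tilde\gamma w^{\mathrm{RIG}}\,dy,\\ x_0^{\mathrm{RIG}}(s)&=\int_0^s\frac{u^{\mathrm{RIG}}}{u^{\mathrm{RIG}}+u_0^{\mathrm{DRIG}}}\,q\,dy,\qquad x_{1+}^{\mathrm{RIG}}(s)=\int_0^s\frac{u^{\mathrm{RIG}}}{u^{\mathrm{RIG}}+u_0^{\mathrm{DRIG}}}\,(1-q)\,dy,\\ x_0^{\mathrm{DRIG}}(s)&=\int_0^s\frac{u_0^{\mathrm{DRIG}}}{u^{\mathrm{RIG}}+u_0^{\mathrm{DRIG}}}\,dy, \end{aligned}$$ where all functions under the integrals are evaluated at $y$ and $$q=\exp\Bigl(-\tilde\gamma w^{\mathrm{RIG}}\bigl(1-e^{-\tilde\gamma(\frac{\sigma}{\sigma+e^{-c}}-x_0^{\mathrm{RIG}}-x_{1+}^{\mathrm{RIG}})}\bigr)\Bigr).$$ Moreover, for every $0\le S<\phi$, every continuous solution of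 this system on $[0,S]$ with $u^{\mathrm{RIG}}+u_0^{\mathrm{DRIG}}>0$ there, and every $\varepsilon>0$, $$\mathbb P\Bigl(\sup_{s\in[0,S]}\Bigl|\frac{U(\lfloor sn\rfloor)}n-(u^{\mathrm{RIG}}+u_0^{\mathrm{DRIG}})(s)\Bigr|>\varepsilon\Bigr)\to0 \quad\text{and}\quad \mathbb P\Bigl(\sup_{s\in[0,S]}\Bigl|\frac{X(\lfloor sn\rfloor)}n-(x_0^{\mathrm{RIG}}+x_{1+}^{\mathrm{RIG}}+x_0^{\mathrm{DRIG}})(s)\Bigr|>\varepsilon\Bigr)\to0$$ as $M\to\infty$ (equivalently, as $n\to\infty$). -/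

import Mathlib

open scoped ENNReal

noncomputable section

namespace MixtureExploration

/-! ### The random bipartite incidence structure behind the random intersection graph -/

/-- Incidence between `N` vertices and `m` attributes:
`A v a = true` means that vertex `v` is connected to attribute `a`. -/
abbrev Incidence (N m : ℕ) : Type := Fin N → Fin m → Bool

/-- The probability of an incidence configuration when every vertex is connected to every attribute
independently with probability `p`. -/
def incidenceWeight {N m : ℕ} (p : ℝ≥0∞) (A : Incidence N m) : ℝ≥0∞ :=
  ∏ v, ∏ a, if A v a then p else 1 - p

theorem sum_incidenceWeight (N m : ℕ) {p : ℝ≥0∞} (hp : p ≤ 1) :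
    ∑ A : Incidence N m, incidenceWeight p A = 1 := by
  have key : ∀ (k : ℕ) (B : Type) [Fintype B] (f : B → ℝ≥0∞), ∑ b, f b = 1 →
      ∑ g : Fin k → B, ∏ i, f (g i) = 1 := by
    intro k B _ f hf
    have h := Finset.sum_prod_piFinset (ι := Fin k) (Finset.univ : Finset B) (fun _ b => f b)
    rw [Fintype.piFinset_univ] at h
    rw [h]
    simp [hf]
  unfold incidenceWeight
  refine key N (Fin m → Bool) (fun r => ∏ a, if r a then p else 1 - p) ?_
  refine key m Bool (fun b => if b then p else 1 - p) ?_
  simp [add_tsub_cancel_of_le hp]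

/-- The law of the incidence structure: all vertex-attribute connections are independent, each
present with probability `p`. -/
def incidencePMF (N m : ℕ) (p : ℝ≥0∞) (hp : p ≤ 1) : PMF (Incidence N m) :=
  PMF.ofFintype (incidenceWeight p) (sum_incidenceWeight N m hp)

/-- The set of attributes connected to the vertex `v`. -/
def attributes {N m : ℕ} (A : Incidence N m) (v : Fin N) : Finset (Fin m) :=
  Finset.univ.filter fun a => A v a = true

/-- The set of neighbours of `v` in the random intersection graph: the other vertices that share at
least one attribute with `v`. -/
def neighbors {N m : ℕ} (A : Incidence N m) (v : Fin N) : Finset (Fin N) :=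
  Finset.univ.filter fun w => v ≠ w ∧ (attributes A v ∩ attributes A w).Nonempty

/-! ### The exploration algorithm -/

/-- The sets tracked by the exploration of the mixture of a random intersection graph on `Fin N`
with attribute set `Fin m` and of a graph consisting of the isolated vertices `Fin K`. -/
structure State (N m K : ℕ) where
  /-- excited vertices that are isolated in the random intersection graph -/
  x0RIG : Finset (Fin N)
  /-- excited vertices that have at least one neighbour in the random intersection graph -/
  x1RIG : Finset (Fin N)
  /-- excited vertices among the additional isolated vertices -/
  x0DRIG : Finset (Fin K)
  /-- unaffected vertices of the random intersection graph -/
  uRIG : Finset (Fin N)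
  /-- unaffected vertices among the additional isolated vertices -/
  u0DRIG : Finset (Fin K)
  /-- unaffected attributes: no vertex connected to them has been excited -/
  wRIG : Finset (Fin m)

/-- Initially all vertices and attributes are unaffected. -/
def State.init (N m K : ℕ) : State N m K where
  x0RIG := ∅
  x1RIG := ∅
  x0DRIG := ∅
  uRIG := Finset.univ
  u0DRIG := Finset.univ
  wRIG := Finset.univ

/-- The set of all unaffected vertices of the mixture. -/
def State.unaffected {N m K : ℕ} (E : State N m K) : Finset (Fin N ⊕ Fin K) :=
  E.uRIG.disjSum E.u0DRIG

/-- The number of unaffected vertices. -/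
def State.numUnaffected {N m K : ℕ} (E : State N m K) : ℕ :=
  E.uRIG.card + E.u0DRIG.card

/-- The number of excited vertices. -/
def State.numExcited {N m K : ℕ} (E : State N m K) : ℕ :=
  E.x0RIG.card + E.x1RIG.card + E.x0DRIG.card

/-- The update of the sets when the given vertex becomes excited. -/
def excite {N m K : ℕ} (A : Incidence N m) (E : State N m K) : Fin N ⊕ Fin K → State N m K
  | Sum.inl v =>
    { x0RIG := if neighbors A v = ∅ then insert v E.x0RIG else E.x0RIG
      x1RIG := if neighbors A v = ∅ then E.x1RIG else insert v E.x1RIG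
      x0DRIG := E.x0DRIG
      uRIG := E.uRIG \ insert v (neighbors A v)
      u0DRIG := E.u0DRIG
      wRIG := E.wRIG \ attributes A v }
  | Sum.inr v =>
    { x0RIG := E.x0RIG
      x1RIG := E.x1RIG
      x0DRIG := insert v E.x0DRIG
      uRIG := E.uRIG
      u0DRIG := E.u0DRIG.erase v
      wRIG := E.wRIG }

open Classical in
/-- One iteration: an unaffected vertex is selected uniformly at random and excited; if there is no
unaffected vertex, then nothing changes. -/
def stepPMF {N m K : ℕ} (A : Incidence N m) (E : State N m K) : PMF (State N m K) :=
  if h : E.unaffected.Nonempty then (PMF.uniformOfFinset E.unaffected h).map (excite A E)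
  else PMF.pure E

/-- The law, given the incidence structure, of the trajectory of the exploration during the first
`T` iterations. A trajectory is recorded as a function of the iteration, constant from `T` on. -/
def trajectoryPMF {N m K : ℕ} (A : Incidence N m) : ℕ → PMF (ℕ → State N m K)
  | 0 => PMF.pure fun _ => State.init N m K
  | T + 1 => (trajectoryPMF A T).bind fun ω =>
      (stepPMF A (ω T)).map fun E t => if t ≤ T then ω t else E

/-! ### Parameters, as functions of the size `M` of the decoupled random intersection graph -/

/-- `ξ₀ = exp (-β γ (1 - e^{-γ}))`. -/
def xi (β γ : ℝ) : ℝ := Real.exp (-(β * γ * (1 - Real.exp (-γ))))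

/-- `σ = (1 - e^{-c}) / (1 - ξ₀)`. -/
def sigma (β γ c : ℝ) : ℝ := (1 - Real.exp (-c)) / (1 - xi β γ)

/-- The number of vertices of the random intersection graph, `⌊σ M⌋`. -/
def nRIG (β γ c : ℝ) (M : ℕ) : ℕ := ⌊sigma β γ c * M⌋₊

/-- The number of additional isolated vertices, `⌊e^{-c} M⌋`. -/
def nIso (c : ℝ) (M : ℕ) : ℕ := ⌊Real.exp (-c) * M⌋₊

/-- The total number `n` of vertices of the mixture. -/
def nTotal (β γ c : ℝ) (M : ℕ) : ℕ := nRIG β γ c M + nIso c M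

/-- The number of attributes, `⌊β n^RIG⌋`. -/
def nAttr (β γ c : ℝ) (M : ℕ) : ℕ := ⌊β * nRIG β γ c M⌋₊

/-- The connection probability `γ / n^RIG`, capped at one (the cap is inactive as soon as
`n^RIG ≥ γ`). -/
def connProb (β γ c : ℝ) (M : ℕ) : ℝ≥0∞ := min 1 (ENNReal.ofReal (γ / nRIG β γ c M))

/-- Trajectories of the exploration of the mixture. -/
abbrev Path (β γ c : ℝ) (M : ℕ) : Type :=
  ℕ → State (nRIG β γ c M) (nAttr β γ c M) (nIso c M)

/-- The law of the trajectory of the exploration of the mixture, for `n` iterations: the random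
intersection graph is drawn, and then explored. -/
def explorationPMF (β γ c : ℝ) (M : ℕ) : PMF (Path β γ c M) :=
  (incidencePMF (nRIG β γ c M) (nAttr β γ c M) (connProb β γ c M) (min_le_left _ _)).bind
    fun A => trajectoryPMF A (nTotal β γ c M)

/-- The probability of an event that concerns the trajectory of the exploration. -/
def explorationProb (β γ c : ℝ) (M : ℕ) (event : Set (Path β γ c M)) : ℝ≥0∞ :=
  (explorationPMF β γ c M).toOuterMeasure event

/-- The scaled process `U(⌊s n⌋) / n` of unaffected vertices. -/
def scaledUnaffected (β γ c : ℝ) (M : ℕ) (ω : Path β γ c M) (s : ℝ) : ℝ :=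
  ((ω ⌊s * nTotal β γ c M⌋₊).numUnaffected : ℝ) / nTotal β γ c M

/-- The scaled process `X(⌊s n⌋) / n` of excited vertices. -/
def scaledExcited (β γ c : ℝ) (M : ℕ) (ω : Path β γ c M) (s : ℝ) : ℝ :=
  ((ω ⌊s * nTotal β γ c M⌋₊).numExcited : ℝ) / nTotal β γ c M

/-! ### The limiting jamming fraction -/

/-- The system of integral equations on `[0, 1]` that determines the jamming limit of the random
intersection graph. -/
structure IsJammingSolution (β γ : ℝ) (u w : ℝ → ℝ) : Prop where
  continuousOn_u : ContinuousOn u (Set.Icc 0 1)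
  continuousOn_w : ContinuousOn w (Set.Icc 0 1)
  u_eq : ∀ s ∈ Set.Icc (0 : ℝ) 1, u s = 1 - s - ∫ y in (0 : ℝ)..s, γ ^ 2 * u y * w y
  w_eq : ∀ s ∈ Set.Icc (0 : ℝ) 1, w s = β - ∫ y in (0 : ℝ)..s, γ * w y

/-- The first zero in `[0, 1]` of the solution `u` of the system above. -/
def firstZero (β γ : ℝ) : ℝ :=
  sInf {s : ℝ | s ∈ Set.Icc (0 : ℝ) 1 ∧ ∃ u w : ℝ → ℝ, IsJammingSolution β γ u w ∧ u s = 0}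

/-- The limiting fraction `φ` of excited vertices. -/
def jammingFraction (β γ c : ℝ) : ℝ :=
  (Real.exp (-c) + sigma β γ c * firstZero β γ) / (Real.exp (-c) + sigma β γ c)

/-! ### The system of integral equations for the fluid limits -/

/-- The six functions of the system. -/
structure FluidFunctions where
  uRIG : ℝ → ℝ
  u0DRIG : ℝ → ℝ
  wRIG : ℝ → ℝ
  x0RIG : ℝ → ℝ
  x1RIG : ℝ → ℝ
  x0DRIG : ℝ → ℝ

/-- `γ̃ = (σ + e^{-c}) γ / σ`. -/
def gammaTilde (β γ c : ℝ) : ℝ := (sigma β γ c + Real.exp (-c)) * γ / sigma β γ c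

/-- The fraction `σ / (σ + e^{-c})` of vertices that belong to the random intersection graph. -/
def fracRIG (β γ c : ℝ) : ℝ := sigma β γ c / (sigma β γ c + Real.exp (-c))

/-- The probability that the next excited vertex comes from the random intersection graph. -/
def FluidFunctions.probRIG (F : FluidFunctions) (y : ℝ) : ℝ := F.uRIG y / (F.uRIG y + F.u0DRIG y)

/-- The probability that the next excited vertex is one of the additional isolated vertices. -/
def FluidFunctions.probDRIG (F : FluidFunctions) (y : ℝ) : ℝ :=
  F.u0DRIG y / (F.uRIG y + F.u0DRIG y)

/-- The probability that a selected vertex of the random intersection graph has no neighbours. -/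
def FluidFunctions.probIso (β γ c : ℝ) (F : FluidFunctions) (y : ℝ) : ℝ :=
  Real.exp (-(gammaTilde β γ c * F.wRIG y *
    (1 - Real.exp (-(gammaTilde β γ c * (fracRIG β γ c - F.x0RIG y - F.x1RIG y))))))

/-- The functions `F` are continuous on `[0, S]`, the denominators in the system do not vanish
there, and `F` satisfies the system of integral equations on `[0, S]`. -/
structure IsFluidSolution (β γ c S : ℝ) (F : FluidFunctions) : Prop where
  continuousOn_uRIG : ContinuousOn F.uRIG (Set.Icc 0 S)
  continuousOn_u0DRIG : ContinuousOn F.u0DRIG (Set.Icc 0 S)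
  continuousOn_wRIG : ContinuousOn F.wRIG (Set.Icc 0 S)
  continuousOn_x0RIG : ContinuousOn F.x0RIG (Set.Icc 0 S)
  continuousOn_x1RIG : ContinuousOn F.x1RIG (Set.Icc 0 S)
  continuousOn_x0DRIG : ContinuousOn F.x0DRIG (Set.Icc 0 S)
  pos : ∀ s ∈ Set.Icc 0 S, 0 < F.uRIG s + F.u0DRIG s
  uRIG_eq : ∀ s ∈ Set.Icc 0 S, F.uRIG s = fracRIG β γ c -
    ∫ y in (0 : ℝ)..s, F.probRIG y * (1 + gammaTilde β γ c ^ 2 * F.uRIG y * F.wRIG y)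
  u0DRIG_eq : ∀ s ∈ Set.Icc 0 S,
    F.u0DRIG s = Real.exp (-c) / (sigma β γ c + Real.exp (-c)) - ∫ y in (0 : ℝ)..s, F.probDRIG y
  wRIG_eq : ∀ s ∈ Set.Icc 0 S, F.wRIG s = β * sigma β γ c / (sigma β γ c + Real.exp (-c)) -
    ∫ y in (0 : ℝ)..s, F.probRIG y * (gammaTilde β γ c * F.wRIG y)
  x0RIG_eq : ∀ s ∈ Set.Icc 0 S,
    F.x0RIG s = ∫ y in (0 : ℝ)..s, F.probRIG y * F.probIso β γ c y
  x1RIG_eq : ∀ s ∈ Set.Icc 0 S,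
    F.x1RIG s = ∫ y in (0 : ℝ)..s, F.probRIG y * (1 - F.probIso β γ c y)
  x0DRIG_eq : ∀ s ∈ Set.Icc 0 S, F.x0DRIG s = ∫ y in (0 : ℝ)..s, F.probDRIG y

end MixtureExploration

end

noncomputable section

namespace MixtureExploration

open Filter Topology

/-! ### Explicit solution of the fluid limit system -/

/-! The fluid system is solved in closed form by a change of time. The intersection graph alone, run
in its own time `r`, has limit `exp (-G r) * (1 - H r)` for the unaffected vertices, with `G =
blockingExponent` and `H = blockingIntegral` the primitive of `exp G`. In the mixture, the
intersection graph being a fraction `f` of the vertices, intrinsic time `r` is reached at `clock r =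
f * r + (1 - f) * H r`. Composing with the inverse clock gives a solution on `[0, φ)`
(`exists_isFluidSolution`); positivity there needs only that the first zero is at most the point
where `H` equals one (`firstZero_le`).

Convergence is an `L²` argument around an arbitrary solution. By deferred decisions
(`AgreeOff.chainLaw_eq`), the probability of reaching a state does not depend on the connections
between its unaffected vertices and its unaffected attributes; hence, given the state, these are
still independent with probability `p` (`sum_jointMass_prod_ind`). First and second moments of the
numbers of blocked vertices and of affected attributes follow (`IsBlockLaw`), and give the mean
squared distance to a point after one iteration (`IsBlockLaw.sum_step_le`). The drift is Lipschitz
where the fluid denominator is bounded below (`abs_drift_sub_le`), so the distance to the fluid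
curve satisfies a recursion (`meanSqDist_succ_le`) to which `discrete_gronwall` applies. Chebyshev
gives convergence at fixed times, and monotonicity of the number of unaffected vertices makes it
uniform through a finite grid.

The excited vertices need no estimate of their own. As long as some vertex is unaffected, each
iteration excites exactly one, so `X t = t` (`isInvariant_numExcited`), and the three fluid
functions add up to `s` (`IsFluidSolution.excited_eq`). The claim reduces to the number of
unaffected vertices staying positive on `[0, S]`. -/

/-- The accumulated rate at which an unaffected vertex of the random intersection graph is
blocked, in the intrinsic time of that graph. -/
def blockingExponent (β γ r : ℝ) : ℝ := β * γ * (1 - Real.exp (-(γ * r)))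

/-- The integral of the exponential of `blockingExponent`. -/
def blockingIntegral (β γ r : ℝ) : ℝ := ∫ y in (0 : ℝ)..r, Real.exp (blockingExponent β γ y)

theorem hasDerivAt_blockingExponent (β γ r : ℝ) :
    HasDerivAt (blockingExponent β γ) (γ ^ 2 * β * Real.exp (-(γ * r))) r := by
  have h1 : HasDerivAt (fun r : ℝ => -(γ * r)) (-γ) r := by
    exact ((hasDerivAt_id r).const_mul γ).neg.congr_deriv (by ring)
  have h := (h1.exp.const_sub 1).const_mul (β * γ)
  refine h.congr_deriv ?_
  ring

theorem continuous_blockingExponent (β γ : ℝ) : Continuous (blockingExponent β γ) := by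
  unfold blockingExponent; fun_prop

theorem hasDerivAt_blockingIntegral (β γ r : ℝ) :
    HasDerivAt (blockingIntegral β γ) (Real.exp (blockingExponent β γ r)) r := by
  have hc : Continuous fun y => Real.exp (blockingExponent β γ y) :=
    Real.continuous_exp.comp (continuous_blockingExponent β γ)
  exact (hc.integral_hasStrictDerivAt 0 r).hasDerivAt

theorem continuous_blockingIntegral (β γ : ℝ) : Continuous (blockingIntegral β γ) :=
  continuous_iff_continuousAt.2 fun r => (hasDerivAt_blockingIntegral β γ r).continuousAt

theorem blockingIntegral_zero (β γ : ℝ) : blockingIntegral β γ 0 = 0 := by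
  simp [blockingIntegral]

theorem strictMono_blockingIntegral (β γ : ℝ) : StrictMono (blockingIntegral β γ) :=
  strictMono_of_hasDerivAt_pos (hasDerivAt_blockingIntegral β γ) fun _ => Real.exp_pos _

theorem exists_blockingIntegral_eq_one {β γ : ℝ} (hβ : 0 < β) (hγ : 0 < γ) :
    ∃ r ∈ Set.Icc (0 : ℝ) 1, blockingIntegral β γ r = 1 := by
  have h1 : (1 : ℝ) ≤ blockingIntegral β γ 1 := by
    have h : ∫ _ in (0 : ℝ)..1, (1 : ℝ) ≤ blockingIntegral β γ 1 := by
      refine intervalIntegral.integral_mono_on zero_le_one intervalIntegrable_const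
        ((Real.continuous_exp.comp (continuous_blockingExponent β γ)).intervalIntegrable _ _) ?_
      intro y hy
      refine Real.one_le_exp ?_
      have : Real.exp (-(γ * y)) ≤ 1 := Real.exp_le_one_iff.2 (by nlinarith [hy.1])
      unfold blockingExponent
      have := mul_pos hβ hγ
      nlinarith
    simpa using h
  have := intermediate_value_Icc zero_le_one
    (continuous_blockingIntegral β γ).continuousOn
  exact this ⟨by rw [blockingIntegral_zero]; norm_num, h1⟩

/-- Since `γ ^ 2 * w` is the derivative of `blockingExponent`, the equation for `u` is linear, and
the integrating factor `exp (blockingExponent β γ r)` turns it into a primitive. -/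
theorem isJammingSolution_explicit (β γ : ℝ) :
    IsJammingSolution β γ
      (fun r => Real.exp (-blockingExponent β γ r) * (1 - blockingIntegral β γ r))
      (fun r => β * Real.exp (-(γ * r))) := by
  have hcu : Continuous
      fun r => Real.exp (-blockingExponent β γ r) * (1 - blockingIntegral β γ r) := by
    have := continuous_blockingExponent β γ
    have := continuous_blockingIntegral β γ
    fun_prop
  have hcw : Continuous fun r => β * Real.exp (-(γ * r)) := by fun_prop
  refine ⟨hcu.continuousOn, hcw.continuousOn, fun s _ => ?_, fun s _ => ?_⟩
  · have hd : ∀ r, HasDerivAt (fun r => r + Real.exp (-blockingExponent β γ r) *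
        (1 - blockingIntegral β γ r))
        (-(γ ^ 2 * (Real.exp (-blockingExponent β γ r) * (1 - blockingIntegral β γ r)) *
          (β * Real.exp (-(γ * r))))) r := by
      intro r
      have h := (hasDerivAt_id r).add ((hasDerivAt_blockingExponent β γ r).neg.exp.mul
        ((hasDerivAt_blockingIntegral β γ r).const_sub 1))
      refine h.congr_deriv ?_
      simp only [Pi.neg_apply, mul_neg, ← Real.exp_add, neg_add_cancel, Real.exp_zero]
      ring
    have h := intervalIntegral.integral_eq_sub_of_hasDerivAt (a := 0) (b := s)
      (fun r _ => hd r) (by apply Continuous.intervalIntegrable; fun_prop)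
    rw [intervalIntegral.integral_neg] at h
    simp only [blockingIntegral_zero, blockingExponent] at h ⊢
    simp at h
    linarith
  · have hd : ∀ r, HasDerivAt (fun r => β * Real.exp (-(γ * r)))
        (-(γ * (β * Real.exp (-(γ * r))))) r := by
      intro r
      have h1 : HasDerivAt (fun r : ℝ => -(γ * r)) (-γ) r := by
        exact ((hasDerivAt_id r).const_mul γ).neg.congr_deriv (by ring)
      refine (h1.exp.const_mul β).congr_deriv ?_
      ring
    have h := intervalIntegral.integral_eq_sub_of_hasDerivAt (a := 0) (b := s)
      (fun r _ => hd r) (by apply Continuous.intervalIntegrable; fun_prop)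
    rw [intervalIntegral.integral_neg] at h
    simp at h ⊢
    linarith

theorem bddBelow_zeros (β γ : ℝ) :
    BddBelow {s : ℝ | s ∈ Set.Icc (0 : ℝ) 1 ∧
      ∃ u w : ℝ → ℝ, IsJammingSolution β γ u w ∧ u s = 0} :=
  ⟨0, fun _ hs => hs.1.1⟩

theorem firstZero_nonneg (β γ : ℝ) : 0 ≤ firstZero β γ :=
  Real.sInf_nonneg fun _ hs => hs.1.1

/-- The infimum runs over zeros of all solutions, so exhibiting one solution bounds it from above.
This direction is all that is needed, and it spares a uniqueness proof. -/
theorem firstZero_le {β γ r : ℝ} (hr : r ∈ Set.Icc (0 : ℝ) 1)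
    (h : blockingIntegral β γ r = 1) : firstZero β γ ≤ r :=
  csInf_le (bddBelow_zeros β γ) ⟨hr, _, _, isJammingSolution_explicit β γ, by simp [h]⟩

theorem sigma_pos {β γ c : ℝ} (hβ : 0 < β) (hγ : 0 < γ) (hc : 0 < c) : 0 < sigma β γ c := by
  have h1 : Real.exp (-c) < 1 := Real.exp_lt_one_iff.2 (by linarith)
  have h2 : Real.exp (-γ) < 1 := Real.exp_lt_one_iff.2 (by linarith)
  have h3 : xi β γ < 1 := by
    refine Real.exp_lt_one_iff.2 ?_
    have := mul_pos (mul_pos hβ hγ) (sub_pos.2 h2)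
    linarith
  exact div_pos (by linarith) (by linarith)

theorem jammingFraction_pos {β γ c : ℝ} (hβ : 0 < β) (hγ : 0 < γ) (hc : 0 < c) :
    0 < jammingFraction β γ c := by
  have h1 := sigma_pos hβ hγ hc
  have h2 := Real.exp_pos (-c)
  have h3 := mul_nonneg h1.le (firstZero_nonneg β γ)
  exact div_pos (by linarith) (by linarith)

theorem jammingFraction_le_one {β γ c : ℝ} (hβ : 0 < β) (hγ : 0 < γ) (hc : 0 < c) :
    jammingFraction β γ c ≤ 1 := by
  obtain ⟨r, hr, hH⟩ := exists_blockingIntegral_eq_one hβ hγ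
  have h1 := sigma_pos hβ hγ hc
  have h2 := Real.exp_pos (-c)
  have h3 := (firstZero_le hr hH).trans hr.2
  rw [jammingFraction, div_le_one (by linarith)]
  nlinarith

/-- The time of the exploration as a function of the intrinsic time of the random intersection
graph, when it makes up the fraction `f` of the vertices. -/
def clock (β γ f r : ℝ) : ℝ := f * r + (1 - f) * blockingIntegral β γ r

theorem hasDerivAt_clock (β γ f r : ℝ) :
    HasDerivAt (clock β γ f) (f + (1 - f) * Real.exp (blockingExponent β γ r)) r := by
  have h := ((hasDerivAt_id r).const_mul f).add
    ((hasDerivAt_blockingIntegral β γ r).const_mul (1 - f))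
  exact h.congr_deriv (by ring)

theorem clock_deriv_pos {f : ℝ} (hf : 0 < f) (hf1 : f < 1) (β γ r : ℝ) :
    0 < f + (1 - f) * Real.exp (blockingExponent β γ r) := by
  have := mul_pos (sub_pos.2 hf1) (Real.exp_pos (blockingExponent β γ r))
  linarith

/-- The clock is strictly increasing and dominates `f * r` in absolute value, with the same sign,
hence it is a bijection of the whole line. A globally defined inverse avoids one-sided derivatives
at `0`. -/
theorem exists_clock_inverse (β γ : ℝ) {f : ℝ} (hf : 0 < f) (hf1 : f < 1) :
    ∃ R : ℝ → ℝ, R 0 = 0 ∧ StrictMono R ∧ (∀ s, clock β γ f (R s) = s) ∧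
      (∀ r, R (clock β γ f r) = r) ∧
      ∀ s, HasDerivAt R (f + (1 - f) * Real.exp (blockingExponent β γ (R s)))⁻¹ s := by
  have hmono : StrictMono (clock β γ f) :=
    strictMono_of_hasDerivAt_pos (hasDerivAt_clock β γ f) (clock_deriv_pos hf hf1 β γ)
  have hcont : Continuous (clock β γ f) :=
    continuous_iff_continuousAt.2 fun r => (hasDerivAt_clock β γ f r).continuousAt
  have h0 : clock β γ f 0 = 0 := by simp [clock, blockingIntegral_zero]
  have hsurj : Function.Surjective (clock β γ f) := by
    refine hcont.surjective ?_ ?_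
    · refine tendsto_atTop_mono' _ ?_ (tendsto_id.const_mul_atTop hf)
      filter_upwards [eventually_ge_atTop 0] with r hr
      have : 0 ≤ blockingIntegral β γ r := by
        rw [← blockingIntegral_zero β γ]; exact (strictMono_blockingIntegral β γ).monotone hr
      have := mul_nonneg (sub_nonneg.2 hf1.le) this
      simp only [id, clock]; linarith
    · refine tendsto_atBot_mono' _ ?_ (tendsto_id.const_mul_atBot hf)
      filter_upwards [eventually_le_atBot 0] with r hr
      have : blockingIntegral β γ r ≤ 0 := by
        rw [← blockingIntegral_zero β γ]; exact (strictMono_blockingIntegral β γ).monotone hr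
      have := mul_nonpos_of_nonneg_of_nonpos (sub_nonneg.2 hf1.le) this
      simp only [id, clock]; linarith
  let e := hmono.orderIsoOfSurjective _ hsurj
  have hR : ∀ s, clock β γ f (e.symm s) = s := fun s => e.apply_symm_apply s
  have hL : ∀ r, e.symm (clock β γ f r) = r := fun r => e.symm_apply_apply r
  refine ⟨e.symm, ?_, e.symm.strictMono, hR, hL, fun s => ?_⟩
  · conv_lhs => rw [← h0]
    exact hL 0
  · exact HasDerivAt.of_local_left_inverse e.symm.continuous.continuousAt
      (hasDerivAt_clock β γ f _) (clock_deriv_pos hf hf1 β γ _).ne' (Eventually.of_forall hR)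

theorem fracRIG_pos {β γ c : ℝ} (hβ : 0 < β) (hγ : 0 < γ) (hc : 0 < c) :
    0 < fracRIG β γ c :=
  div_pos (sigma_pos hβ hγ hc) (add_pos (sigma_pos hβ hγ hc) (Real.exp_pos _))

theorem one_sub_fracRIG {β γ c : ℝ} (hβ : 0 < β) (hγ : 0 < γ) (hc : 0 < c) :
    1 - fracRIG β γ c = Real.exp (-c) / (sigma β γ c + Real.exp (-c)) := by
  have := add_pos (sigma_pos hβ hγ hc) (Real.exp_pos (-c))
  rw [fracRIG]
  field_simp
  ring

theorem fracRIG_lt_one {β γ c : ℝ} (hβ : 0 < β) (hγ : 0 < γ) (hc : 0 < c) :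
    fracRIG β γ c < 1 := by
  have h := one_sub_fracRIG hβ hγ hc
  have := div_pos (Real.exp_pos (-c)) (add_pos (sigma_pos hβ hγ hc) (Real.exp_pos (-c)))
  linarith

theorem gammaTilde_eq (β γ c : ℝ) : gammaTilde β γ c = γ / fracRIG β γ c := by
  rw [gammaTilde, fracRIG, div_div_eq_mul_div]
  ring

/-- In this form `φ` can be compared with the clock at a point where `blockingIntegral` is one. -/
theorem jammingFraction_eq {β γ c : ℝ} (hβ : 0 < β) (hγ : 0 < γ) (hc : 0 < c) :
    jammingFraction β γ c = fracRIG β γ c * firstZero β γ + (1 - fracRIG β γ c) := by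
  have := add_pos (sigma_pos hβ hγ hc) (Real.exp_pos (-c))
  rw [one_sub_fracRIG hβ hγ hc, jammingFraction, fracRIG, add_comm (Real.exp (-c)) (sigma β γ c)]
  field_simp
  ring

/-- All functions are closed forms in the inverse clock `R`, smooth on the line; the equations then
follow by differentiating. Only the identification of the two shares requires positivity, hence `s ≤
S`. -/
theorem exists_isFluidSolution {β γ c : ℝ} (hβ : 0 < β) (hγ : 0 < γ) (hc : 0 < c) :
    ∃ F : FluidFunctions, ∀ S : ℝ, 0 ≤ S → S < jammingFraction β γ c →
      IsFluidSolution β γ c S F := by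
  obtain ⟨r₁, hr₁, hH₁⟩ := exists_blockingIntegral_eq_one hβ hγ
  have hfz := firstZero_le hr₁ hH₁
  have hφ := jammingFraction_eq hβ hγ hc
  have hg := one_sub_fracRIG hβ hγ hc
  have hf := fracRIG_pos hβ hγ hc
  have hf1 := fracRIG_lt_one hβ hγ hc
  have hβf : β * sigma β γ c / (sigma β γ c + Real.exp (-c)) = fracRIG β γ c * β := by
    rw [fracRIG]; ring
  have hγf := gammaTilde_eq β γ c
  set f := fracRIG β γ c with hfdef
  set g := gammaTilde β γ c with hgdef
  obtain ⟨R, hR0, hRmono, hRr, hRl, hRd⟩ := exists_clock_inverse β γ hf hf1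
  have hRc : Continuous R := continuous_iff_continuousAt.2 fun s => (hRd s).continuousAt
  have hGc := continuous_blockingExponent β γ
  have hHc := continuous_blockingIntegral β γ
  -- `ρ` is `f * R'`. It is the share of the intersection graph after the common factor `1 -
  -- blockingIntegral` is cancelled, and it stays meaningful where that factor vanishes.
  let ρ : ℝ → ℝ := fun s => f * (f + (1 - f) * Real.exp (blockingExponent β γ (R s)))⁻¹
  have hdpos := fun s => clock_deriv_pos hf hf1 β γ (R s)
  have hρc : Continuous ρ :=
    continuous_const.mul (Continuous.inv₀ (by fun_prop) fun s => (hdpos s).ne')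
  let w : ℝ → ℝ := fun s => f * β * Real.exp (-(γ * R s))
  let u : ℝ → ℝ := fun s =>
    f * (Real.exp (-blockingExponent β γ (R s)) * (1 - blockingIntegral β γ (R s)))
  let k : ℝ → ℝ := fun s => (1 - f) * (1 - blockingIntegral β γ (R s))
  have hwc : Continuous w := by fun_prop
  have huc : Continuous u := by fun_prop
  have hkc : Continuous k := by fun_prop
  -- Here `f * R s` stands for `x0RIG + x1RIG`. The sum is known in advance because `q` cancels in
  -- it, so `q` can be defined before its two primitives without circularity.
  let q : ℝ → ℝ := fun s => Real.exp (-(g * w s * (1 - Real.exp (-(g * (f - f * R s))))))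
  have hqc : Continuous q := by fun_prop
  let F : FluidFunctions :=
    { uRIG := u
      u0DRIG := k
      wRIG := w
      x0RIG := fun s => ∫ y in (0 : ℝ)..s, ρ y * q y
      x1RIG := fun s => ∫ y in (0 : ℝ)..s, ρ y * (1 - q y)
      x0DRIG := fun s => ∫ y in (0 : ℝ)..s, (1 - ρ y) }
  refine ⟨F, fun S hS hSφ => ?_⟩
  -- `S < φ ≤ f * r₁ + (1 - f) = clock r₁`, so the intrinsic time is still before `r₁`.
  have hlt : ∀ s, s ≤ S → 0 < 1 - blockingIntegral β γ (R s) := by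
    intro s hs
    have h1 : s < clock β γ f r₁ := by
      have : clock β γ f r₁ = f * r₁ + (1 - f) := by simp [clock, hH₁]
      rw [this]
      have := mul_le_mul_of_nonneg_left hfz hf.le
      linarith
    have h2 : R s < r₁ := by rw [← hRl r₁]; exact hRmono h1
    have := strictMono_blockingIntegral β γ h2
    linarith
  have hupos : ∀ s, s ≤ S → 0 < u s := fun s hs =>
    mul_pos hf (mul_pos (Real.exp_pos _) (hlt s hs))
  have hkpos : ∀ s, s ≤ S → 0 < k s := fun s hs =>
    mul_pos (by linarith) (hlt s hs)
  have hprob : ∀ s, s ≤ S → F.probRIG s = ρ s := by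
    intro s hs
    have h1 := (hlt s hs).ne'
    have h2 := (hdpos s).ne'
    have h3 := (add_pos (hupos s hs) (hkpos s hs)).ne'
    change u s / (u s + k s) = ρ s
    rw [div_eq_iff h3]
    simp only [ρ, u, k]
    rw [Real.exp_neg]
    field_simp
    rw [mul_comm (1 - f)] at h2
    exact (div_self h2).symm
  have hprob0 : ∀ s, s ≤ S → F.probDRIG s = 1 - ρ s := by
    intro s hs
    rw [← hprob s hs]
    have h3 := (add_pos (hupos s hs) (hkpos s hs)).ne'
    change k s / (u s + k s) = 1 - u s / (u s + k s)
    field_simp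
    ring
  have hτ : ∀ s, ∫ y in (0 : ℝ)..s, ρ y = f * R s := by
    intro s
    have h := intervalIntegral.integral_eq_sub_of_hasDerivAt (a := 0) (b := s)
      (fun y _ => (hRd y).const_mul f) (hρc.intervalIntegrable _ _)
    rw [h, hR0]; ring
  have hsum : ∀ s, F.x0RIG s + F.x1RIG s = f * R s := by
    intro s
    change (∫ y in (0 : ℝ)..s, ρ y * q y) + (∫ y in (0 : ℝ)..s, ρ y * (1 - q y)) = _
    rw [← intervalIntegral.integral_add
      (by apply Continuous.intervalIntegrable; fun_prop)
      (by apply Continuous.intervalIntegrable; fun_prop), ← hτ s]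
    congr 1; ext y; ring
  have hiso : ∀ s, F.probIso β γ c s = q s := by
    intro s
    simp only [FluidFunctions.probIso, q, F, ← hgdef, ← hfdef]
    rw [sub_sub, show (∫ y in (0 : ℝ)..s, ρ y * q y) + (∫ y in (0 : ℝ)..s, ρ y * (1 - q y))
      = f * R s from hsum s]
  have hmem : ∀ {s y : ℝ}, s ∈ Set.Icc 0 S → y ∈ Set.uIcc 0 s → y ≤ S := by
    intro s y hs hy
    rw [Set.uIcc_of_le hs.1] at hy
    exact hy.2.trans hs.2
  have hI : ∀ {s : ℝ} (a : ℝ → ℝ), s ∈ Set.Icc 0 S →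
      ∫ y in (0 : ℝ)..s, F.probRIG y * a y = ∫ y in (0 : ℝ)..s, ρ y * a y := by
    intro s a hs
    refine intervalIntegral.integral_congr fun y hy => ?_
    simp only [hprob y (hmem hs hy)]
  have hI0 : ∀ {s : ℝ}, s ∈ Set.Icc 0 S →
      ∫ y in (0 : ℝ)..s, F.probDRIG y = ∫ y in (0 : ℝ)..s, (1 - ρ y) := by
    intro s hs
    exact intervalIntegral.integral_congr fun y hy => hprob0 y (hmem hs hy)
  have hud : ∀ s, HasDerivAt u (-(ρ s * (1 + g ^ 2 * u s * w s))) s := by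
    intro s
    have hG := (hasDerivAt_blockingExponent β γ (R s)).comp s (hRd s)
    have hH := (hasDerivAt_blockingIntegral β γ (R s)).comp s (hRd s)
    have h := (hG.neg.exp.mul (hH.const_sub 1)).const_mul f
    refine h.congr_deriv ?_
    have h2 := (hdpos s).ne'
    simp only [ρ, u, w, hγf, Function.comp, Pi.neg_apply, Real.exp_neg]
    field_simp
    ring
  have hkd : ∀ s, HasDerivAt k (-(1 - ρ s)) s := by
    intro s
    have hH := (hasDerivAt_blockingIntegral β γ (R s)).comp s (hRd s)
    refine ((hH.const_sub 1).const_mul (1 - f)).congr_deriv ?_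
    have h2 := (hdpos s).ne'
    simp only [ρ]
    field_simp
    ring
  have hwd : ∀ s, HasDerivAt w (-(ρ s * (g * w s))) s := by
    intro s
    refine (((hRd s).const_mul γ).neg.exp.const_mul (f * β)).congr_deriv ?_
    have h2 := (hdpos s).ne'
    simp only [ρ, w, hγf, Pi.neg_apply]
    field_simp
  have hu0 : u 0 = f := by simp [u, hR0, blockingIntegral_zero, blockingExponent]
  have hk0 : k 0 = 1 - f := by simp [k, hR0, blockingIntegral_zero]
  have hw0 : w 0 = f * β := by simp [w, hR0]
  have hint : ∀ {a b : ℝ → ℝ} {s : ℝ}, (∀ y, HasDerivAt a (-b y) y) → Continuous b →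
      a s = a 0 - ∫ y in (0 : ℝ)..s, b y := by
    intro a b s hab hb
    have h := intervalIntegral.integral_eq_sub_of_hasDerivAt (a := 0) (b := s)
      (fun y _ => hab y) (hb.neg.intervalIntegrable _ _)
    rw [intervalIntegral.integral_neg] at h
    linarith
  have hprim : ∀ {a : ℝ → ℝ}, Continuous a →
      ContinuousOn (fun s => ∫ y in (0 : ℝ)..s, a y) (Set.Icc 0 S) := fun ha =>
    (continuous_iff_continuousAt.2 fun s =>
      (ha.integral_hasStrictDerivAt 0 s).hasDerivAt.continuousAt).continuousOn
  exact
    { continuousOn_uRIG := huc.continuousOn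
      continuousOn_u0DRIG := hkc.continuousOn
      continuousOn_wRIG := hwc.continuousOn
      continuousOn_x0RIG := hprim (by fun_prop)
      continuousOn_x1RIG := hprim (by fun_prop)
      continuousOn_x0DRIG := hprim (by fun_prop)
      pos := fun s hs => add_pos (hupos s hs.2) (hkpos s hs.2)
      uRIG_eq := fun s hs => by
        rw [hI _ hs, ← hfdef, ← hu0]
        exact hint (b := fun y => ρ y * (1 + g ^ 2 * u y * w y)) hud (by fun_prop)
      u0DRIG_eq := fun s hs => by
        rw [hI0 hs, ← hg, ← hk0]
        exact hint hkd (by fun_prop)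
      wRIG_eq := fun s hs => by
        rw [hI _ hs, hβf, ← hw0]
        exact hint (b := fun y => ρ y * (g * w y)) hwd (by fun_prop)
      x0RIG_eq := fun s hs => by
        rw [hI _ hs]; simp only [hiso]; rfl
      x1RIG_eq := fun s hs => by
        rw [hI _ hs]; simp only [hiso]; rfl
      x0DRIG_eq := fun s hs => by rw [hI0 hs] }

/-! ### Expectations of probability mass functions on finite types -/

theorem pmf_sum_toReal {α : Type*} [Fintype α] (p : PMF α) : ∑ x, (p x).toReal = 1 := by
  have h := p.tsum_coe
  rw [tsum_fintype] at h
  rw [← ENNReal.toReal_sum fun x _ => p.apply_ne_top x, h, ENNReal.toReal_one]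

theorem pmf_bind_toReal {α β : Type*} [Fintype α] (p : PMF α) (f : α → PMF β) (y : β) :
    ((p.bind f) y).toReal = ∑ x, (p x).toReal * (f x y).toReal := by
  rw [PMF.bind_apply, tsum_fintype, ENNReal.toReal_sum fun x _ =>
    ENNReal.mul_ne_top (p.apply_ne_top x) ((f x).apply_ne_top y)]
  simp only [ENNReal.toReal_mul]

theorem pmf_sum_bind {α β : Type*} [Fintype α] [Fintype β] (p : PMF α) (f : α → PMF β)
    (h : β → ℝ) : ∑ y, ((p.bind f) y).toReal * h y =
      ∑ x, (p x).toReal * ∑ y, (f x y).toReal * h y := by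
  simp only [pmf_bind_toReal, Finset.sum_mul, Finset.mul_sum]
  rw [Finset.sum_comm]
  simp only [mul_assoc]

theorem pmf_sum_pure {α : Type*} [Fintype α] (x : α) (h : α → ℝ) :
    ∑ y, (PMF.pure x y).toReal * h y = h x := by
  classical
  rw [Finset.sum_eq_single x]
  · simp
  · intro y _ hy
    simp [PMF.pure_apply, hy]
  · simp

theorem pmf_sum_map {α β : Type*} [Fintype α] [Fintype β] (p : PMF α) (f : α → β)
    (h : β → ℝ) : ∑ y, ((p.map f) y).toReal * h y = ∑ x, (p x).toReal * h (f x) := by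
  rw [← PMF.bind_pure_comp, pmf_sum_bind]
  simp only [Function.comp, pmf_sum_pure]

theorem pmf_sum_uniformOfFinset {α : Type*} [Fintype α] (s : Finset α) (hs : s.Nonempty)
    (h : α → ℝ) :
    ∑ x, (PMF.uniformOfFinset s hs x).toReal * h x = (∑ x ∈ s, h x) / s.card := by
  classical
  rw [Finset.sum_div, ← Finset.sum_subset (Finset.subset_univ s)]
  · refine Finset.sum_congr rfl fun x hx => ?_
    rw [PMF.uniformOfFinset_apply_of_mem hs hx, ENNReal.toReal_inv, ENNReal.toReal_natCast]
    ring
  · intro x _ hx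
    rw [PMF.uniformOfFinset_apply_of_notMem hs hx]
    simp

/-! ### The chain of states -/

instance (N m K : ℕ) : Fintype (State N m K) :=
  Fintype.ofInjective
    (fun E : State N m K => (E.x0RIG, E.x1RIG, E.x0DRIG, E.uRIG, E.u0DRIG, E.wRIG)) <| by
      rintro ⟨⟩ ⟨⟩ h
      simpa using h

variable {N m K : ℕ}

/-- The law, given the incidence structure, of the state after `t` iterations. -/
def chainLaw (A : Incidence N m) : ℕ → PMF (State N m K)
  | 0 => PMF.pure (State.init N m K)
  | t + 1 => (chainLaw A t).bind (stepPMF A)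

/-- Later iterations do not alter the recorded value at `t`, so fixed-time marginals are those of a
Markov chain on a finite state space. -/
theorem trajectoryPMF_map (A : Incidence N m) {t T : ℕ} (h : t ≤ T) :
    (trajectoryPMF (K := K) A T).map (fun ω => ω t) = chainLaw A t := by
  induction T generalizing t with
  | zero =>
    obtain rfl : t = 0 := by omega
    simp [trajectoryPMF, chainLaw, PMF.pure_map]
  | succ T ih =>
    rw [trajectoryPMF, PMF.map_bind]
    rcases Nat.lt_or_ge T t with h' | h'
    · obtain rfl : t = T + 1 := by omega
      rw [chainLaw, ← ih le_rfl, PMF.bind_map]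
      congr 1
      funext ω
      rw [PMF.map_comp]
      simp only [Function.comp_def, Nat.not_succ_le_self, if_false]
      exact PMF.map_id _
    · rw [← ih h', ← PMF.bind_pure_comp]
      congr 1
      funext ω
      rw [PMF.map_comp]
      simp only [Function.comp_def, h', if_true]
      exact PMF.map_const _ _

/-- A property of states that holds initially and is preserved by every iteration. -/
structure IsInvariant (A : Incidence N m) (P : ℕ → State N m K → Prop) : Prop where
  init : P 0 (State.init N m K)
  step : ∀ t E v, P t E → v ∈ E.unaffected → P (t + 1) (excite A E v)
  idle : ∀ t E, P t E → ¬ E.unaffected.Nonempty → P (t + 1) E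

theorem mem_support_stepPMF {A : Incidence N m} {E E' : State N m K}
    (h : E' ∈ (stepPMF A E).support) :
    (∃ v ∈ E.unaffected, E' = excite A E v) ∨ (¬ E.unaffected.Nonempty ∧ E' = E) := by
  unfold stepPMF at h
  split_ifs at h with hU
  · rw [PMF.mem_support_map_iff] at h
    obtain ⟨v, hv, rfl⟩ := h
    exact Or.inl ⟨v, (PMF.mem_support_uniformOfFinset_iff hU v).1 hv, rfl⟩
  · rw [PMF.mem_support_pure_iff] at h
    exact Or.inr ⟨hU, h⟩

theorem IsInvariant.of_step {A : Incidence N m} {P : ℕ → State N m K → Prop}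
    (hP : IsInvariant A P) {t : ℕ} {E E' : State N m K} (hE : P t E)
    (h : E' ∈ (stepPMF A E).support) : P (t + 1) E' := by
  rcases mem_support_stepPMF h with ⟨v, hv, rfl⟩ | ⟨hU, rfl⟩
  · exact hP.step t E v hE hv
  · exact hP.idle t _ hE hU

theorem IsInvariant.chainLaw {A : Incidence N m} {P : ℕ → State N m K → Prop}
    (hP : IsInvariant A P) {t : ℕ} {E : State N m K} (h : E ∈ (chainLaw A t).support) :
    P t E := by
  induction t generalizing E with
  | zero =>
    rw [MixtureExploration.chainLaw, PMF.mem_support_pure_iff] at h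
    rw [h]
    exact hP.init
  | succ t ih =>
    rw [MixtureExploration.chainLaw, PMF.mem_support_bind_iff] at h
    obtain ⟨E₀, h₀, h⟩ := h
    exact hP.of_step (ih h₀) h

theorem trajectoryPMF_support {A : Incidence N m} {T : ℕ} {ω : ℕ → State N m K}
    (h : ω ∈ (trajectoryPMF A T).support) :
    ω 0 = State.init N m K ∧ ∀ t < T, ω (t + 1) ∈ (stepPMF A (ω t)).support := by
  induction T generalizing ω with
  | zero =>
    rw [trajectoryPMF, PMF.mem_support_pure_iff] at h
    simp [h]
  | succ T ih =>
    rw [trajectoryPMF, PMF.mem_support_bind_iff] at h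
    obtain ⟨ω₀, h₀, h⟩ := h
    rw [PMF.mem_support_map_iff] at h
    obtain ⟨E, hE, rfl⟩ := h
    obtain ⟨h1, h2⟩ := ih h₀
    refine ⟨by simpa using h1, fun t ht => ?_⟩
    rcases Nat.lt_succ_iff_lt_or_eq.1 ht with h' | rfl
    · have h3 : t + 1 ≤ T := h'
      simp only [h3, h'.le, if_true]
      exact h2 t h'
    · simpa using hE

theorem IsInvariant.trajectory {A : Incidence N m} {P : ℕ → State N m K → Prop}
    (hP : IsInvariant A P) {T t : ℕ} {ω : ℕ → State N m K}
    (h : ω ∈ (trajectoryPMF A T).support) (ht : t ≤ T) : P t (ω t) := by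
  obtain ⟨h1, h2⟩ := trajectoryPMF_support h
  induction t with
  | zero => rw [h1]; exact hP.init
  | succ t ih => exact hP.of_step (ih (by omega)) (h2 t (by omega))

theorem mem_attributes {A : Incidence N m} {v : Fin N} {a : Fin m} :
    a ∈ attributes A v ↔ A v a = true := by
  simp [attributes]

theorem mem_neighbors {A : Incidence N m} {v x : Fin N} :
    x ∈ neighbors A v ↔ v ≠ x ∧ ∃ a, A v a = true ∧ A x a = true := by
  simp [neighbors, Finset.Nonempty, mem_attributes]

/-- Unaffected vertices are connected to unaffected attributes only. -/
theorem isInvariant_unaffected (A : Incidence N m) :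
    IsInvariant (K := K) A fun _ E => ∀ v ∈ E.uRIG, ∀ a ∉ E.wRIG, A v a = false where
  init := by simp [State.init]
  step := by
    rintro _ E (x | x) hE hx v hv a ha
    · simp only [excite, Finset.mem_sdiff, Finset.mem_insert, not_or] at hv ha
      -- An attribute that has just become affected belongs to the excited vertex `x`; any vertex
      -- connected to it is a neighbour of `x` and has been removed.
      have hxa : a ∈ E.wRIG → A x a = true := fun h =>
        by_contra fun h' => ha ⟨h, fun h'' => h' (mem_attributes.1 h'')⟩
      by_contra hva
      rw [Bool.not_eq_false] at hva
      have haw : a ∈ E.wRIG := by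
        by_contra haw
        rw [hE v hv.1 a haw] at hva
        simp at hva
      exact hv.2.2 (mem_neighbors.2 ⟨Ne.symm hv.2.1, a, hxa haw, hva⟩)
    · exact hE v hv a ha
  idle := fun _ _ h _ => h

/-- The excited vertices are counted by the iterations while there are unaffected vertices. -/
theorem isInvariant_numExcited (A : Incidence N m) :
    IsInvariant (K := K) A fun t E => Disjoint E.x0RIG E.uRIG ∧ Disjoint E.x1RIG E.uRIG ∧
      Disjoint E.x0DRIG E.u0DRIG ∧ (0 < E.numUnaffected → E.numExcited = t) where
  init := by simp [State.init, State.numExcited]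
  step := by
    rintro t E v ⟨h1, h2, h3, h4⟩ hv
    have hpos : 0 < E.numUnaffected := by
      have : 0 < E.unaffected.card := Finset.card_pos.2 ⟨v, hv⟩
      simpa [State.unaffected, State.numUnaffected, Finset.card_disjSum] using this
    have h5 := h4 hpos
    rcases v with v | v
    -- Disjointness of excited and unaffected sets is carried in the invariant so that each
    -- insertion really adds an element.
    · have hvu : v ∈ E.uRIG := by simpa [State.unaffected] using hv
      have hx0 : v ∉ E.x0RIG := fun h => Finset.disjoint_left.1 h1 h hvu
      have hx1 : v ∉ E.x1RIG := fun h => Finset.disjoint_left.1 h2 h hvu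
      have hd1 : Disjoint E.x0RIG (E.uRIG \ insert v (neighbors A v)) :=
        h1.mono_right Finset.sdiff_subset
      have hd2 : Disjoint E.x1RIG (E.uRIG \ insert v (neighbors A v)) :=
        h2.mono_right Finset.sdiff_subset
      have hvn : v ∉ E.uRIG \ insert v (neighbors A v) := by simp
      unfold excite State.numExcited at *
      by_cases hn : neighbors A v = ∅
      · simp only [hn, if_true] at *
        refine ⟨Finset.disjoint_insert_left.2 ⟨hvn, hd1⟩, hd2, h3, fun _ => ?_⟩
        rw [Finset.card_insert_of_notMem hx0]
        omega
      · simp only [hn, if_false] at *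
        refine ⟨hd1, Finset.disjoint_insert_left.2 ⟨hvn, hd2⟩, h3, fun _ => ?_⟩
        rw [Finset.card_insert_of_notMem hx1]
        omega
    · have hvu : v ∈ E.u0DRIG := by simpa [State.unaffected] using hv
      have hx0 : v ∉ E.x0DRIG := fun h => Finset.disjoint_left.1 h3 h hvu
      refine ⟨h1, h2, Finset.disjoint_insert_left.2
        ⟨Finset.notMem_erase _ _, h3.mono_right (Finset.erase_subset _ _)⟩, fun _ => ?_⟩
      simp only [excite, State.numExcited, Finset.card_insert_of_notMem hx0] at *
      omega
  idle := by
    rintro t E ⟨h1, h2, h3, _⟩ hU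
    refine ⟨h1, h2, h3, fun hpos => absurd ?_ hU⟩
    rw [← Finset.card_pos]
    simpa [State.unaffected, State.numUnaffected, Finset.card_disjSum] using hpos

theorem numUnaffected_excite_le (A : Incidence N m) (E : State N m K) (v : Fin N ⊕ Fin K) :
    (excite A E v).numUnaffected ≤ E.numUnaffected := by
  rcases v with v | v
  · exact add_le_add (Finset.card_le_card Finset.sdiff_subset) le_rfl
  · exact add_le_add le_rfl (Finset.card_le_card (Finset.erase_subset _ _))

theorem numUnaffected_antitone {A : Incidence N m} {T : ℕ} {ω : ℕ → State N m K}
    (h : ω ∈ (trajectoryPMF A T).support) {s t : ℕ} (hst : s ≤ t) (ht : t ≤ T) :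
    (ω t).numUnaffected ≤ (ω s).numUnaffected := by
  obtain ⟨_, h2⟩ := trajectoryPMF_support h
  induction t, hst using Nat.le_induction with
  | base => exact le_rfl
  | succ t _ ih =>
    refine le_trans ?_ (ih (by omega))
    rcases mem_support_stepPMF (h2 t (by omega)) with ⟨v, _, h⟩ | ⟨_, h⟩
    · rw [h]; exact numUnaffected_excite_le A _ v
    · rw [h]

/-! ### Deferred decisions -/

/-- Two incidence structures agree except between unaffected vertices and unaffected attributes. -/
def AgreeOff (E : State N m K) (A A' : Incidence N m) : Prop :=
  ∀ v a, ¬ (v ∈ E.uRIG ∧ a ∈ E.wRIG) → A v a = A' v a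

theorem AgreeOff.symm {E : State N m K} {A A' : Incidence N m} (h : AgreeOff E A A') :
    AgreeOff E A' A := fun v a hva => (h v a hva).symm

/-- Exciting `v` reads only the row of `v` and the columns of the attributes of `v`. After the
excitation `v` and these attributes are affected, so all these entries lie outside the block of
`E'`, where the two structures agree. -/
theorem AgreeOff.excite_eq {E E' : State N m K} {A A' : Incidence N m} (h : AgreeOff E' A A')
    {v : Fin N ⊕ Fin K} (hE : E' = excite A E v) : E' = excite A' E v := by
  rcases v with v | v
  · have hu : E'.uRIG = E.uRIG \ insert v (neighbors A v) := by rw [hE]; rfl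
    have hw : E'.wRIG = E.wRIG \ attributes A v := by rw [hE]; rfl
    have hrow : ∀ a, A v a = A' v a := fun a => h v a fun hh => by simp [hu] at hh
    have hattr : attributes A v = attributes A' v := by
      ext a; simp [mem_attributes, hrow]
    have hcol : ∀ x a, A v a = true → A x a = A' x a := fun x a ha => h x a fun hh => by
      simp [hw, mem_attributes, ha] at hh
    have hnbr : neighbors A v = neighbors A' v := by
      ext x
      simp only [mem_neighbors, ← hrow]
      refine and_congr_right fun _ => exists_congr fun a => and_congr_right fun ha => ?_
      rw [hcol x a ha]
    rw [hE]
    simp only [excite, hattr, hnbr]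
  · exact hE

theorem AgreeOff.stepPMF_eq {E E' : State N m K} {A A' : Incidence N m} (h : AgreeOff E' A A') :
    stepPMF A E E' = stepPMF A' E E' := by
  unfold stepPMF
  split_ifs with hU
  · classical
    rw [PMF.map_apply, PMF.map_apply]
    refine tsum_congr fun v => ?_
    have : E' = excite A E v ↔ E' = excite A' E v := ⟨h.excite_eq, h.symm.excite_eq⟩
    simp only [this]
  · rfl

/-- Unaffected sets only shrink, so agreement off the block of `E` implies agreement off the larger
block of every possible predecessor, and the induction goes through. -/
theorem AgreeOff.chainLaw_eq {E : State N m K} {A A' : Incidence N m} (h : AgreeOff E A A')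
    (t : ℕ) : chainLaw A t E = chainLaw A' t E := by
  induction t generalizing E with
  | zero => rfl
  | succ t ih =>
    rw [chainLaw, chainLaw, PMF.bind_apply, PMF.bind_apply]
    refine tsum_congr fun E₀ => ?_
    rw [h.stepPMF_eq]
    by_cases h0 : stepPMF A' E₀ E = 0
    · simp [h0]
    · have h1 : E.uRIG ⊆ E₀.uRIG ∧ E.wRIG ⊆ E₀.wRIG := by
        rcases mem_support_stepPMF ((PMF.mem_support_iff _ _).2 h0) with ⟨v | v, _, rfl⟩ | ⟨_, rfl⟩
        · exact ⟨Finset.sdiff_subset, Finset.sdiff_subset⟩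
        · exact ⟨subset_rfl, subset_rfl⟩
        · exact ⟨subset_rfl, subset_rfl⟩
      rw [ih fun v a hva => h v a fun hh => hva ⟨h1.1 hh.1, h1.2 hh.2⟩]

/-- The probability of an incidence configuration, as a real number. -/
def realWeight (p : ℝ) (A : Incidence N m) : ℝ :=
  ∏ e : Fin N × Fin m, if A e.1 e.2 then p else 1 - p

theorem realWeight_nonneg {p : ℝ} (h0 : 0 ≤ p) (h1 : p ≤ 1) (A : Incidence N m) :
    0 ≤ realWeight p A :=
  Finset.prod_nonneg fun e _ => by split_ifs <;> linarith

theorem incidencePMF_toReal {p : ℝ≥0∞} (hp : p ≤ 1) (A : Incidence N m) :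
    (incidencePMF N m p hp A).toReal = realWeight p.toReal A := by
  rw [incidencePMF, PMF.ofFintype_apply, incidenceWeight, realWeight, Fintype.prod_prod_type,
    ENNReal.toReal_prod]
  refine Finset.prod_congr rfl fun v _ => ?_
  rw [ENNReal.toReal_prod]
  refine Finset.prod_congr rfl fun a _ => ?_
  split_ifs
  · rfl
  · rw [ENNReal.toReal_sub_of_le hp ENNReal.one_ne_top, ENNReal.toReal_one]

/-- The indicator of the connection `e`. -/
def ind (A : Incidence N m) (e : Fin N × Fin m) : ℝ := if A e.1 e.2 then 1 else 0

/-- The incidence structure with the connection `e` replaced by its opposite. -/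
def flipAt (e : Fin N × Fin m) (A : Incidence N m) : Incidence N m := fun v a =>
  if (v, a) = e then !(A v a) else A v a

theorem flipAt_flipAt (e : Fin N × Fin m) (A : Incidence N m) : flipAt e (flipAt e A) = A := by
  funext v a
  by_cases h : (v, a) = e <;> simp [flipAt, h]

theorem flipAt_self (e : Fin N × Fin m) (A : Incidence N m) :
    flipAt e A e.1 e.2 = !(A e.1 e.2) := by
  simp [flipAt]

theorem flipAt_of_ne {e e' : Fin N × Fin m} (h : e' ≠ e) (A : Incidence N m) :
    flipAt e A e'.1 e'.2 = A e'.1 e'.2 := by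
  simp [flipAt, h]

/-- Pair each configuration with the one flipped at `e`. As `G` takes the same value on both, the
two differences between the sides cancel: `p - p ^ 2` from the present connection against `-p * (1 -
p)` from the absent one. -/
theorem sum_realWeight_ind (p : ℝ) (e : Fin N × Fin m) {G : Incidence N m → ℝ}
    (hG : ∀ A, G (flipAt e A) = G A) :
    ∑ A, realWeight p A * (ind A e * G A) = p * ∑ A, realWeight p A * G A := by
  rw [← sub_eq_zero, Finset.mul_sum, ← Finset.sum_sub_distrib]
  have hw : ∀ A : Incidence N m, realWeight p A = (if A e.1 e.2 then p else 1 - p) *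
      ∏ e' ∈ Finset.univ.erase e, if A e'.1 e'.2 then p else 1 - p := fun A =>
    (Finset.mul_prod_erase _ _ (Finset.mem_univ e)).symm
  have hr : ∀ A : Incidence N m,
      (∏ e' ∈ Finset.univ.erase e, if flipAt e A e'.1 e'.2 then p else 1 - p) =
        ∏ e' ∈ Finset.univ.erase e, if A e'.1 e'.2 then p else 1 - p := fun A =>
    Finset.prod_congr rfl fun e' he' => by rw [flipAt_of_ne (Finset.ne_of_mem_erase he')]
  refine Finset.sum_involution (fun A _ => flipAt e A) ?_ ?_ (fun _ _ => Finset.mem_univ _)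
    fun A _ => flipAt_flipAt e A
  · intro A _
    rw [hw A, hw (flipAt e A), hr, hG]
    simp only [ind, flipAt_self]
    cases A e.1 e.2 <;> simp <;> ring
  · intro A _ _ h
    have := congrFun (congrFun h e.1) e.2
    rw [flipAt_self] at this
    simp at this

theorem sum_realWeight_prod_ind (p : ℝ) (s : Finset (Fin N × Fin m)) {G : Incidence N m → ℝ}
    (hG : ∀ e ∈ s, ∀ A, G (flipAt e A) = G A) :
    ∑ A, realWeight p A * ((∏ e ∈ s, ind A e) * G A) =
      p ^ s.card * ∑ A, realWeight p A * G A := by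
  induction s using Finset.induction_on with
  | empty => simp
  | insert e s he ih =>
    have h1 : ∀ A : Incidence N m, (∏ e ∈ insert e s, ind A e) * G A =
        ind A e * ((∏ e ∈ s, ind A e) * G A) := fun A => by
      rw [Finset.prod_insert he]; ring
    simp only [h1]
    rw [sum_realWeight_ind p e (G := fun A => (∏ e ∈ s, ind A e) * G A),
      ih fun e' he' => hG e' (Finset.mem_insert_of_mem he'), Finset.card_insert_of_notMem he]
    · ring
    · intro A
      simp only [hG e (Finset.mem_insert_self _ _) A]
      congr 1
      refine Finset.prod_congr rfl fun e' he' => ?_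
      rw [ind, ind, flipAt_of_ne (ne_of_mem_of_not_mem he' he)]

/-- The joint law of the incidence structure and of the state after `t` iterations. -/
def jointMass (p : ℝ) (t : ℕ) (E : State N m K) (A : Incidence N m) : ℝ :=
  realWeight p A * (chainLaw A t E).toReal

theorem jointMass_nonneg {p : ℝ} (h0 : 0 ≤ p) (h1 : p ≤ 1) (t : ℕ) (E : State N m K)
    (A : Incidence N m) : 0 ≤ jointMass p t E A :=
  mul_nonneg (realWeight_nonneg h0 h1 A) ENNReal.toReal_nonneg

/-- The chain law at `E` is unchanged by flips inside the block of `E`, so the indicators there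
factor out one at a time. -/
theorem sum_jointMass_prod_ind (p : ℝ) (t : ℕ) (E : State N m K) (s : Finset (Fin N × Fin m))
    (hs : s ⊆ E.uRIG ×ˢ E.wRIG) :
    ∑ A, jointMass p t E A * ∏ e ∈ s, ind A e = p ^ s.card * ∑ A, jointMass p t E A := by
  unfold jointMass
  rw [← sum_realWeight_prod_ind p s (G := fun A => (chainLaw A t E).toReal)]
  · refine Finset.sum_congr rfl fun A _ => by ring
  · intro e he A
    congr 1
    refine AgreeOff.chainLaw_eq (fun v a hva => ?_) t
    have : (v, a) ≠ e := by
      rintro rfl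
      exact hva (Finset.mem_product.1 (hs he))
    simp [flipAt, this]

theorem jointMass_support {p : ℝ} {t : ℕ} {E : State N m K} {A : Incidence N m}
    (h : jointMass p t E A ≠ 0) : ∀ v ∈ E.uRIG, ∀ a ∉ E.wRIG, A v a = false := by
  refine (isInvariant_unaffected (K := K) A).chainLaw (t := t) ((PMF.mem_support_iff _ _).2 ?_)
  intro h0
  exact h (by simp [jointMass, h0])

/-! ### Moments of the numbers of blocked vertices and of affected attributes -/

/-- A law on incidence structures under which the connections between the vertices in `u` and the
attributes in `w` are independent with probability `p`, and the vertices in `u` are not connected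
to other attributes. -/
structure IsBlockLaw (p : ℝ) (u : Finset (Fin N)) (w : Finset (Fin m))
    (μ : Incidence N m → ℝ) : Prop where
  nonneg : ∀ A, 0 ≤ μ A
  prod_ind : ∀ s ⊆ u ×ˢ w, ∑ A, μ A * ∏ e ∈ s, ind A e = p ^ s.card * ∑ A, μ A
  support : ∀ A, μ A ≠ 0 → ∀ v ∈ u, ∀ a ∉ w, A v a = false

/-- The law is left unnormalised, with total mass the probability of `E`. This avoids conditioning
and a separate treatment of states of probability zero. -/
theorem isBlockLaw_jointMass {p : ℝ} (h0 : 0 ≤ p) (h1 : p ≤ 1) (t : ℕ) (E : State N m K) :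
    IsBlockLaw p E.uRIG E.wRIG (jointMass p t E) where
  nonneg := jointMass_nonneg h0 h1 t E
  prod_ind := sum_jointMass_prod_ind p t E
  support := fun _ h => jointMass_support h

theorem ind_mul_self (A : Incidence N m) (e : Fin N × Fin m) : ind A e * ind A e = ind A e := by
  unfold ind; split_ifs <;> simp

/-- The number of attributes in `w` shared by `v` and `x`. -/
def shared (A : Incidence N m) (w : Finset (Fin m)) (v x : Fin N) : ℝ :=
  ∑ a ∈ w, ind A (v, a) * ind A (x, a)

/-- The number of attributes in `w` connected to `v`. -/
def touched (A : Incidence N m) (w : Finset (Fin m)) (v : Fin N) : ℝ := ∑ a ∈ w, ind A (v, a)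

/-- The number of vertices in `u` blocked by the excitation of `v`. -/
def blocked (A : Incidence N m) (u : Finset (Fin N)) (v : Fin N) : ℝ :=
  ∑ x ∈ u.erase v, if x ∈ neighbors A v then 1 else 0

theorem shared_eq_card (A : Incidence N m) (w : Finset (Fin m)) (v x : Fin N) :
    shared A w v x = ((w.filter fun a => A v a = true ∧ A x a = true).card : ℝ) := by
  rw [shared, Finset.card_filter, Nat.cast_sum]
  refine Finset.sum_congr rfl fun a _ => ?_
  simp only [ind]
  cases A v a <;> cases A x a <;> simp

theorem card_wRIG_sdiff (A : Incidence N m) (w : Finset (Fin m)) (v : Fin N) :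
    ((w \ attributes A v).card : ℝ) = w.card - touched A w v := by
  have h : touched A w v = ((w ∩ attributes A v).card : ℝ) := by
    rw [touched, ← Finset.filter_mem_eq_inter, Finset.card_filter, Nat.cast_sum]
    refine Finset.sum_congr rfl fun a _ => ?_
    simp [ind, mem_attributes]
  rw [h, eq_sub_iff_add_eq]
  exact_mod_cast Finset.card_sdiff_add_card_inter w (attributes A v)

theorem card_uRIG_sdiff (A : Incidence N m) {u : Finset (Fin N)} {v : Fin N} (hv : v ∈ u) :
    ((u \ insert v (neighbors A v)).card : ℝ) = u.card - (1 + blocked A u v) := by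
  have h1 : u \ insert v (neighbors A v) = u.erase v \ neighbors A v := by
    ext x
    simp only [Finset.mem_sdiff, Finset.mem_insert, Finset.mem_erase, not_or]
    tauto
  have h : blocked A u v = ((u.erase v ∩ neighbors A v).card : ℝ) := by
    rw [blocked, ← Finset.filter_mem_eq_inter, Finset.card_filter, Nat.cast_sum]
    refine Finset.sum_congr rfl fun a _ => ?_
    simp
  have h2 : ((u.erase v \ neighbors A v).card : ℝ) + ((u.erase v ∩ neighbors A v).card : ℝ) =
      (u.erase v).card := by
    exact_mod_cast Finset.card_sdiff_add_card_inter (u.erase v) (neighbors A v)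
  have h3 : ((u.erase v).card : ℝ) + 1 = u.card := by
    exact_mod_cast Finset.card_erase_add_one hv
  rw [h1, h]
  linarith

namespace IsBlockLaw

variable {p : ℝ} {u : Finset (Fin N)} {w : Finset (Fin m)} {μ : Incidence N m → ℝ}

theorem sum_mono (hμ : IsBlockLaw p u w μ) {f g : Incidence N m → ℝ}
    (h : ∀ A, μ A ≠ 0 → f A ≤ g A) : ∑ A, μ A * f A ≤ ∑ A, μ A * g A := by
  refine Finset.sum_le_sum fun A _ => ?_
  by_cases h0 : μ A = 0
  · simp [h0]
  · exact mul_le_mul_of_nonneg_left (h A h0) (hμ.nonneg A)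

theorem sum_ind (hμ : IsBlockLaw p u w μ) {v : Fin N} {a : Fin m} (hv : v ∈ u) (ha : a ∈ w) :
    ∑ A, μ A * ind A (v, a) = p * ∑ A, μ A := by
  have h := hμ.prod_ind {(v, a)} (by simp [hv, ha])
  simpa using h

theorem sum_ind_pair (hμ : IsBlockLaw p u w μ) {e e' : Fin N × Fin m} (he : e ∈ u ×ˢ w)
    (he' : e' ∈ u ×ˢ w) (hne : e ≠ e') :
    ∑ A, μ A * (ind A e * ind A e') = p ^ 2 * ∑ A, μ A := by
  have h := hμ.prod_ind {e, e'} (by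
    simp only [Finset.insert_subset_iff, Finset.singleton_subset_iff]; exact ⟨he, he'⟩)
  rw [Finset.card_pair hne] at h
  simpa only [Finset.prod_pair hne] using h

/-- The power of `p` counts distinct connections: four if `a ≠ b`, three if `a = b` and `x ≠ y`
since `(v, a)` is repeated, two if both coincide. -/
theorem sum_ind_quad (hμ : IsBlockLaw p u w μ) (hp : 0 ≤ p) {v x y : Fin N} {a b : Fin m}
    (hv : v ∈ u) (hx : x ∈ u.erase v) (hy : y ∈ u.erase v) (ha : a ∈ w) (hb : b ∈ w) :
    ∑ A, μ A * ((ind A (v, a) * ind A (x, a)) * (ind A (v, b) * ind A (y, b))) ≤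
      (p ^ 4 + (if a = b then p ^ 3 else 0) + if a = b then if x = y then p ^ 2 else 0 else 0) *
        ∑ A, μ A := by
  have hπ : 0 ≤ ∑ A, μ A := Finset.sum_nonneg fun A _ => hμ.nonneg A
  rw [Finset.mem_erase] at hx hy
  have hva : (v, a) ∈ u ×ˢ w := Finset.mk_mem_product hv ha
  have hvb : (v, b) ∈ u ×ˢ w := Finset.mk_mem_product hv hb
  have hxa : (x, a) ∈ u ×ˢ w := Finset.mk_mem_product hx.2 ha
  have hyb : (y, b) ∈ u ×ˢ w := Finset.mk_mem_product hy.2 hb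
  by_cases hab : a = b
  · subst hab
    simp only [if_true]
    by_cases hxy : x = y
    · subst hxy
      have h : ∀ A : Incidence N m, (ind A (v, a) * ind A (x, a)) *
          (ind A (v, a) * ind A (x, a)) = ind A (v, a) * ind A (x, a) := fun A => by
        rw [mul_mul_mul_comm, ind_mul_self, ind_mul_self]
      simp only [h, if_true]
      rw [hμ.sum_ind_pair hva hxa (by simp [Ne.symm hx.1])]
      refine mul_le_mul_of_nonneg_right ?_ hπ
      have := pow_nonneg hp 4
      have := pow_nonneg hp 3
      linarith
    · have hs := hμ.prod_ind {(v, a), (x, a), (y, a)} (by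
        simp only [Finset.insert_subset_iff, Finset.singleton_subset_iff]
        exact ⟨hva, hxa, hyb⟩)
      have h : ∀ A : Incidence N m, (ind A (v, a) * ind A (x, a)) *
          (ind A (v, a) * ind A (y, a)) = ∏ e ∈ {(v, a), (x, a), (y, a)}, ind A e := fun A => by
        rw [Finset.prod_insert (by simp [Ne.symm hx.1, Ne.symm hy.1]),
          Finset.prod_pair (by simp [hxy]), mul_mul_mul_comm, ind_mul_self]
      simp only [h, hxy, if_false]
      rw [hs, Finset.card_eq_three.2 ⟨_, _, _, by simp [Ne.symm hx.1],
        by simp [Ne.symm hy.1], by simp [hxy], rfl⟩]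
      refine mul_le_mul_of_nonneg_right ?_ hπ
      have := pow_nonneg hp 4
      linarith
  · have hs := hμ.prod_ind {(v, a), (x, a), (v, b), (y, b)} (by
      simp only [Finset.insert_subset_iff, Finset.singleton_subset_iff]
      exact ⟨hva, hxa, hvb, hyb⟩)
    have h : ∀ A : Incidence N m, (ind A (v, a) * ind A (x, a)) *
        (ind A (v, b) * ind A (y, b)) =
          ∏ e ∈ {(v, a), (x, a), (v, b), (y, b)}, ind A e := fun A => by
      rw [Finset.prod_insert (by simp [Ne.symm hx.1, hab]),
        Finset.prod_insert (by simp [hab]),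
        Finset.prod_pair (by simp [Ne.symm hy.1]), mul_assoc]
    have hc : ({(v, a), (x, a), (v, b), (y, b)} : Finset (Fin N × Fin m)).card = 4 := by
      rw [Finset.card_insert_of_notMem (by simp [Ne.symm hx.1, hab]),
        Finset.card_insert_of_notMem (by simp [hab]),
        Finset.card_pair (by simp [Ne.symm hy.1])]
    simp only [h, hab, if_false]
    rw [hs, hc]
    simp

theorem sum_touched (hμ : IsBlockLaw p u w μ) {v : Fin N} (hv : v ∈ u) :
    ∑ A, μ A * touched A w v = w.card * p * ∑ A, μ A := by
  simp only [touched, Finset.mul_sum (s := w)]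
  rw [Finset.sum_comm, Finset.sum_congr rfl fun a ha => hμ.sum_ind hv ha]
  simp [mul_assoc]

theorem sum_touched_sq_le (hμ : IsBlockLaw p u w μ) {v : Fin N} (hv : v ∈ u) :
    ∑ A, μ A * touched A w v ^ 2 ≤ ((w.card * p) ^ 2 + w.card * p) * ∑ A, μ A := by
  have hπ : 0 ≤ ∑ A, μ A := Finset.sum_nonneg fun A _ => hμ.nonneg A
  simp only [touched, sq, Finset.sum_mul_sum]
  simp only [Finset.mul_sum (s := w)]
  rw [Finset.sum_comm]
  have h : ∀ a ∈ w, ∑ A, ∑ b ∈ w, μ A * (ind A (v, a) * ind A (v, b)) ≤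
      (w.card * p ^ 2 + p) * ∑ A, μ A := by
    intro a ha
    rw [Finset.sum_comm]
    have h' : ∀ b ∈ w, ∑ A, μ A * (ind A (v, a) * ind A (v, b)) ≤
        (p ^ 2 + if a = b then p else 0) * ∑ A, μ A := by
      intro b hb
      by_cases hab : a = b
      · subst hab
        simp only [ind_mul_self, if_true]
        rw [hμ.sum_ind hv ha]
        exact mul_le_mul_of_nonneg_right (by nlinarith) hπ
      · rw [hμ.sum_ind_pair (Finset.mk_mem_product hv ha) (Finset.mk_mem_product hv hb)
          (by simp [hab])]
        simp [hab]
    refine (Finset.sum_le_sum h').trans_eq ?_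
    rw [← Finset.sum_mul, Finset.sum_add_distrib]
    simp [ha]
  refine (Finset.sum_le_sum h).trans_eq ?_
  rw [Finset.sum_const, nsmul_eq_mul]
  ring

theorem sum_shared (hμ : IsBlockLaw p u w μ) {v x : Fin N} (hv : v ∈ u) (hx : x ∈ u.erase v) :
    ∑ A, μ A * shared A w v x = w.card * p ^ 2 * ∑ A, μ A := by
  rw [Finset.mem_erase] at hx
  simp only [shared, Finset.mul_sum (s := w)]
  rw [Finset.sum_comm, Finset.sum_congr rfl fun a ha =>
    hμ.sum_ind_pair (Finset.mk_mem_product hv ha) (Finset.mk_mem_product hx.2 ha)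
      (by simp [Ne.symm hx.1])]
  simp [mul_assoc]

theorem sum_shared_mul_shared_le (hμ : IsBlockLaw p u w μ) (hp : 0 ≤ p) {v x y : Fin N}
    (hv : v ∈ u) (hx : x ∈ u.erase v) (hy : y ∈ u.erase v) :
    ∑ A, μ A * (shared A w v x * shared A w v y) ≤
      (w.card ^ 2 * p ^ 4 + w.card * p ^ 3 + if x = y then w.card * p ^ 2 else 0) *
        ∑ A, μ A := by
  simp only [shared, Finset.sum_mul_sum]
  simp only [Finset.mul_sum (s := w)]
  rw [Finset.sum_comm]
  have h : ∀ a ∈ w, ∑ A, ∑ b ∈ w, μ A * (ind A (v, a) * ind A (x, a) *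
      (ind A (v, b) * ind A (y, b))) ≤
      (w.card * p ^ 4 + p ^ 3 + if x = y then p ^ 2 else 0) * ∑ A, μ A := by
    intro a ha
    rw [Finset.sum_comm]
    refine (Finset.sum_le_sum fun b hb => hμ.sum_ind_quad hp hv hx hy ha hb).trans_eq ?_
    rw [← Finset.sum_mul, Finset.sum_add_distrib, Finset.sum_add_distrib]
    simp [ha]
  refine (Finset.sum_le_sum h).trans_eq ?_
  rw [Finset.sum_const, nsmul_eq_mul]
  split_ifs <;> ring

/-- For a natural number `k` of shared attributes, `2 * k - k ^ 2 ≤ 1_{k ≥ 1} ≤ k`, the left part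
being `(k - 1) ^ 2 ≥ 0`. Counting in `w` alone suffices because `v` has no attribute outside `w`. -/
theorem indicator_neighbor_bounds (hμ : IsBlockLaw p u w μ) {A : Incidence N m} (hA : μ A ≠ 0)
    {v x : Fin N} (hv : v ∈ u) (hx : x ∈ u.erase v) :
    (if x ∈ neighbors A v then (1 : ℝ) else 0) ≤ shared A w v x ∧
      2 * shared A w v x - shared A w v x * shared A w v x ≤
        if x ∈ neighbors A v then (1 : ℝ) else 0 := by
  rw [Finset.mem_erase] at hx
  rw [shared_eq_card]
  set s := w.filter fun a => A v a = true ∧ A x a = true with hs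
  have hiff : x ∈ neighbors A v ↔ s.Nonempty := by
    rw [mem_neighbors]
    constructor
    · rintro ⟨_, a, h1, h2⟩
      refine ⟨a, Finset.mem_filter.2 ⟨?_, h1, h2⟩⟩
      by_contra ha
      rw [hμ.support A hA v hv a ha] at h1
      simp at h1
    · rintro ⟨a, ha⟩
      exact ⟨Ne.symm hx.1, a, (Finset.mem_filter.1 ha).2⟩
  by_cases h : s.Nonempty
  · rw [if_pos (hiff.2 h)]
    have h1 : (1 : ℝ) ≤ s.card := by exact_mod_cast Finset.card_pos.2 h
    exact ⟨h1, by nlinarith [sq_nonneg ((s.card : ℝ) - 1)]⟩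
  · rw [if_neg (fun h' => h (hiff.1 h')), Finset.not_nonempty_iff_eq_empty.1 h]
    simp

theorem sum_blocked_le (hμ : IsBlockLaw p u w μ) {v : Fin N} (hv : v ∈ u) :
    ∑ A, μ A * blocked A u v ≤ u.card * (w.card * p ^ 2) * ∑ A, μ A := by
  have hπ : 0 ≤ ∑ A, μ A := Finset.sum_nonneg fun A _ => hμ.nonneg A
  simp only [blocked, Finset.mul_sum (s := u.erase v)]
  rw [Finset.sum_comm]
  refine (Finset.sum_le_sum (g := fun _ => w.card * p ^ 2 * ∑ A, μ A) fun x hx => ?_).trans ?_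
  · rw [← hμ.sum_shared hv hx]
    exact hμ.sum_mono fun A hA => (hμ.indicator_neighbor_bounds hA hv hx).1
  · rw [Finset.sum_const, nsmul_eq_mul, ← mul_assoc]
    refine mul_le_mul_of_nonneg_right (mul_le_mul_of_nonneg_right ?_ (by positivity)) hπ
    exact_mod_cast Finset.card_le_card (Finset.erase_subset _ _)

/-- The quadratic lower bound loses the second moment of the shared count, and erasing `v` loses one
summand. With `u` and `w` of order `n` and `p` of order `1 / n`, the total loss is of order `1 / n`.
-/
theorem le_sum_blocked (hμ : IsBlockLaw p u w μ) (hp : 0 ≤ p) {v : Fin N} (hv : v ∈ u) :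
    (u.card * (w.card * p ^ 2) -
      (w.card * p ^ 2 + u.card * (w.card ^ 2 * p ^ 4 + w.card * p ^ 3))) * ∑ A, μ A ≤
      ∑ A, μ A * blocked A u v := by
  have hπ : 0 ≤ ∑ A, μ A := Finset.sum_nonneg fun A _ => hμ.nonneg A
  simp only [blocked, Finset.mul_sum (s := u.erase v)]
  rw [Finset.sum_comm]
  have hx : ∀ x ∈ u.erase v,
      (w.card * p ^ 2 - (w.card ^ 2 * p ^ 4 + w.card * p ^ 3)) * ∑ A, μ A ≤
        ∑ A, μ A * (if x ∈ neighbors A v then (1 : ℝ) else 0) := by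
    intro x hx
    have h1 := hμ.sum_shared hv hx
    have h2 := hμ.sum_shared_mul_shared_le hp hv hx hx
    rw [if_pos rfl] at h2
    have h3 := hμ.sum_mono (f := fun A => 2 * shared A w v x - shared A w v x * shared A w v x)
      fun A hA => (hμ.indicator_neighbor_bounds hA hv hx).2
    have h4 : ∑ A, μ A * (2 * shared A w v x - shared A w v x * shared A w v x) =
        2 * ∑ A, μ A * shared A w v x - ∑ A, μ A * (shared A w v x * shared A w v x) := by
      rw [Finset.mul_sum, ← Finset.sum_sub_distrib]
      exact Finset.sum_congr rfl fun A _ => by ring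
    rw [h4, h1] at h3
    refine le_trans ?_ h3
    linarith
  refine le_trans ?_ (Finset.sum_le_sum hx)
  have hc : ((u.erase v).card : ℝ) + 1 = u.card := by
    exact_mod_cast Finset.card_erase_add_one hv
  rw [Finset.sum_const, nsmul_eq_mul, ← mul_assoc (((u.erase v).card : ℕ) : ℝ), ← hc]
  refine mul_le_mul_of_nonneg_right ?_ hπ
  have h1 : 0 ≤ (w.card : ℝ) ^ 2 * p ^ 4 + w.card * p ^ 3 := by positivity
  linarith

/-- In the regime `p = O(1 / n)` this is bounded, which is all that is required. The term with `p ^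
3` comes from two vertices blocked through the same attribute and does not vanish in the limit. -/
theorem sum_blocked_sq_le (hμ : IsBlockLaw p u w μ) (hp : 0 ≤ p) {v : Fin N} (hv : v ∈ u) :
    ∑ A, μ A * blocked A u v ^ 2 ≤
      (u.card ^ 2 * (w.card ^ 2 * p ^ 4 + w.card * p ^ 3) + u.card * (w.card * p ^ 2)) *
        ∑ A, μ A := by
  have hπ : 0 ≤ ∑ A, μ A := Finset.sum_nonneg fun A _ => hμ.nonneg A
  have h1 : ∑ A, μ A * blocked A u v ^ 2 ≤ ∑ A, μ A * (∑ x ∈ u.erase v, shared A w v x) ^ 2 := by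
    refine hμ.sum_mono fun A hA => pow_le_pow_left₀ ?_ ?_ 2
    · exact Finset.sum_nonneg fun x _ => by split_ifs <;> norm_num
    · exact Finset.sum_le_sum fun x hx => (hμ.indicator_neighbor_bounds hA hv hx).1
  refine h1.trans ?_
  simp only [sq (∑ x ∈ u.erase v, shared _ w v x), Finset.sum_mul_sum]
  simp only [Finset.mul_sum (s := u.erase v)]
  rw [Finset.sum_comm]
  have hc : ((u.erase v).card : ℝ) ≤ u.card := by
    exact_mod_cast Finset.card_le_card (Finset.erase_subset _ _)
  have hq : 0 ≤ (w.card : ℝ) ^ 2 * p ^ 4 + w.card * p ^ 3 := by positivity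
  have h : ∀ x ∈ u.erase v, ∑ A, ∑ y ∈ u.erase v, μ A * (shared A w v x * shared A w v y) ≤
      (u.card * (w.card ^ 2 * p ^ 4 + w.card * p ^ 3) + w.card * p ^ 2) * ∑ A, μ A := by
    intro x hx
    rw [Finset.sum_comm]
    refine (Finset.sum_le_sum fun y hy => hμ.sum_shared_mul_shared_le hp hv hx hy).trans ?_
    rw [← Finset.sum_mul, Finset.sum_add_distrib]
    refine mul_le_mul_of_nonneg_right ?_ hπ
    rw [Finset.sum_ite_eq, if_pos hx, Finset.sum_const, nsmul_eq_mul]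
    linarith [mul_le_mul_of_nonneg_right hc hq]
  refine (Finset.sum_le_sum h).trans ?_
  rw [Finset.sum_const, nsmul_eq_mul, ← mul_assoc]
  refine mul_le_mul_of_nonneg_right ?_ hπ
  refine (mul_le_mul_of_nonneg_right hc (by positivity)).trans_eq ?_
  ring

end IsBlockLaw

/-! ### One iteration of the exploration -/

/-- The squared distance of the scaled numbers of unaffected vertices and attributes to a given
point. -/
def sqDist (n g₁ g₂ g₃ : ℝ) (E : State N m K) : ℝ :=
  (E.uRIG.card / n - g₁) ^ 2 + (E.u0DRIG.card / n - g₂) ^ 2 + (E.wRIG.card / n - g₃) ^ 2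

/-- The second-order error constant of one iteration. -/
def stepError (G b Γ : ℝ) : ℝ :=
  2 * (G * (b * Γ ^ 2 + (b ^ 2 * Γ ^ 4 + b * Γ ^ 3))) +
    (2 + 2 * ((b ^ 2 * Γ ^ 4 + b * Γ ^ 3) + b * Γ ^ 2)) + ((b * Γ) ^ 2 + b * Γ)

theorem one_le_stepError {G b Γ : ℝ} (hG : 0 ≤ G) (hb : 0 ≤ b) (hΓ : 0 ≤ Γ) :
    1 ≤ stepError G b Γ := by
  have h1 : 0 ≤ 2 * (G * (b * Γ ^ 2 + (b ^ 2 * Γ ^ 4 + b * Γ ^ 3))) := by positivity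
  have h2 : 0 ≤ 2 * ((b ^ 2 * Γ ^ 4 + b * Γ ^ 3) + b * Γ ^ 2) := by positivity
  have h3 : 0 ≤ (b * Γ) ^ 2 + b * Γ := by positivity
  unfold stepError
  linarith

/-- Expand the squares around the current state. The cross terms give the drift, with the mean of
`blocked` known up to `O(1 / n)`; the squared increments cost `O(1 / n ^ 2)` by the second moments.
-/
theorem IsBlockLaw.sum_excite_inl_le {p n g₁ g₂ g₃ G b Γ : ℝ} {E : State N m K}
    {μ : Incidence N m → ℝ} (hμ : IsBlockLaw p E.uRIG E.wRIG μ) (hp : 0 ≤ p) (hn : 0 < n)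
    (hu : E.uRIG.card ≤ n) (hw : E.wRIG.card ≤ b * n) (hΓ : p * n ≤ Γ) (hb : 0 ≤ b)
    (hG : |E.uRIG.card / n - g₁| ≤ G) {v : Fin N} (hv : v ∈ E.uRIG) :
    ∑ A, μ A * sqDist n g₁ g₂ g₃ (excite A E (Sum.inl v)) ≤
      (sqDist n g₁ g₂ g₃ E -
        2 / n * ((E.uRIG.card / n - g₁) * (1 + E.uRIG.card * (E.wRIG.card * p ^ 2)) +
          (E.wRIG.card / n - g₃) * (E.wRIG.card * p)) + stepError G b Γ / n ^ 2) *
        ∑ A, μ A := by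
  have hπ : 0 ≤ ∑ A, μ A := Finset.sum_nonneg fun A _ => hμ.nonneg A
  have hG0 : 0 ≤ G := (abs_nonneg _).trans hG
  have hΓ0 : 0 ≤ Γ := (mul_nonneg hp hn.le).trans hΓ
  have hB1 := hμ.sum_blocked_le hv
  have hB2 := hμ.le_sum_blocked hp hv
  have hB3 := hμ.sum_blocked_sq_le hp hv
  have hJ1 := hμ.sum_touched hv
  have hJ2 := hμ.sum_touched_sq_le hv
  set e₁ : ℝ := E.uRIG.card / n - g₁ with he₁
  set e₂ : ℝ := E.u0DRIG.card / n - g₂ with he₂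
  set e₃ : ℝ := E.wRIG.card / n - g₃ with he₃
  set π := ∑ A, μ A with hπd
  have hpt : ∀ A, sqDist n g₁ g₂ g₃ (excite A E (Sum.inl v)) ≤
      (e₁ ^ 2 + e₂ ^ 2 + e₃ ^ 2 - 2 / n * e₁ + 2 / n ^ 2) + (-(2 / n * e₁)) * blocked A E.uRIG v +
        2 / n ^ 2 * blocked A E.uRIG v ^ 2 + (-(2 / n * e₃)) * touched A E.wRIG v +
        1 / n ^ 2 * touched A E.wRIG v ^ 2 := by
    intro A
    have h1 : ((excite A E (Sum.inl v)).uRIG.card : ℝ) / n - g₁ =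
        e₁ - (1 + blocked A E.uRIG v) / n := by
      have := card_uRIG_sdiff A hv
      simp only [excite]
      rw [this, he₁]; ring
    have h3 : ((excite A E (Sum.inl v)).wRIG.card : ℝ) / n - g₃ =
        e₃ - touched A E.wRIG v / n := by
      simp only [excite]
      rw [card_wRIG_sdiff, he₃]; ring
    have h2 : ((excite A E (Sum.inl v)).u0DRIG.card : ℝ) / n - g₂ = e₂ := rfl
    rw [sqDist, h1, h2, h3]
    -- This is `(1 + B) ^ 2 ≤ 2 + 2 * B ^ 2`, which removes the linear term from the squared
    -- increment.
    have h4 : 0 ≤ (1 - blocked A E.uRIG v) ^ 2 / n ^ 2 := by positivity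
    refine le_of_sub_nonneg (h4.trans_eq ?_)
    field_simp
    ring
  refine (hμ.sum_mono fun A _ => hpt A).trans ?_
  have hexp : ∑ A, μ A * ((e₁ ^ 2 + e₂ ^ 2 + e₃ ^ 2 - 2 / n * e₁ + 2 / n ^ 2) +
      (-(2 / n * e₁)) * blocked A E.uRIG v +
        2 / n ^ 2 * blocked A E.uRIG v ^ 2 + (-(2 / n * e₃)) * touched A E.wRIG v +
        1 / n ^ 2 * touched A E.wRIG v ^ 2) =
      (e₁ ^ 2 + e₂ ^ 2 + e₃ ^ 2 - 2 / n * e₁ + 2 / n ^ 2) * π +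
        (-(2 / n * e₁)) * ∑ A, μ A * blocked A E.uRIG v +
        2 / n ^ 2 * ∑ A, μ A * blocked A E.uRIG v ^ 2 +
        (-(2 / n * e₃)) * ∑ A, μ A * touched A E.wRIG v +
        1 / n ^ 2 * ∑ A, μ A * touched A E.wRIG v ^ 2 := by
    simp only [hπd, Finset.mul_sum, ← Finset.sum_add_distrib]
    exact Finset.sum_congr rfl fun A _ => by ring
  rw [hexp, hJ1]
  -- In the rescaled quantities `X ≤ 1`, `W ≤ b`, `P ≤ Γ` the powers of `n` cancel and the bounds
  -- become uniform.
  obtain ⟨X, hX⟩ : ∃ X : ℝ, X = E.uRIG.card / n := ⟨_, rfl⟩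
  obtain ⟨W, hW⟩ : ∃ W : ℝ, W = E.wRIG.card / n := ⟨_, rfl⟩
  obtain ⟨P, hP⟩ : ∃ P : ℝ, P = p * n := ⟨_, rfl⟩
  have hX0 : 0 ≤ X := by rw [hX]; positivity
  have hW0 : 0 ≤ W := by rw [hW]; positivity
  have hP0 : 0 ≤ P := by rw [hP]; positivity
  have hX1 : X ≤ 1 := by rw [hX, div_le_one hn]; exact hu
  have hWb : W ≤ b := by rw [hW, div_le_iff₀ hn]; exact hw
  rw [← hP] at hΓ
  have hcX : (E.uRIG.card : ℝ) = X * n := by rw [hX, div_mul_cancel₀ _ hn.ne']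
  have hcW : (E.wRIG.card : ℝ) = W * n := by rw [hW, div_mul_cancel₀ _ hn.ne']
  have hcp : p = P / n := eq_div_of_mul_eq hn.ne' hP.symm
  have hWP : ∀ i : ℕ, W * P ^ i ≤ b * Γ ^ i := fun i => by gcongr
  have hWWP : W ^ 2 * P ^ 4 + W * P ^ 3 ≤ b ^ 2 * Γ ^ 4 + b * Γ ^ 3 := by gcongr
  have hQ0 : 0 ≤ W ^ 2 * P ^ 4 + W * P ^ 3 := by positivity
  have hdev : |∑ A, μ A * blocked A E.uRIG v - E.uRIG.card * (E.wRIG.card * p ^ 2) * π| ≤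
      (b * Γ ^ 2 + (b ^ 2 * Γ ^ 4 + b * Γ ^ 3)) / n * π := by
    rw [abs_le]
    have h1 : 0 ≤ (b * Γ ^ 2 + (b ^ 2 * Γ ^ 4 + b * Γ ^ 3)) / n * π := by positivity
    have h2 : E.wRIG.card * p ^ 2 + E.uRIG.card * (E.wRIG.card ^ 2 * p ^ 4 + E.wRIG.card * p ^ 3)
        ≤ (b * Γ ^ 2 + (b ^ 2 * Γ ^ 4 + b * Γ ^ 3)) / n := by
      have h : E.wRIG.card * p ^ 2 +
          E.uRIG.card * (E.wRIG.card ^ 2 * p ^ 4 + E.wRIG.card * p ^ 3) =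
          (W * P ^ 2 + X * (W ^ 2 * P ^ 4 + W * P ^ 3)) / n := by
        rw [hcX, hcW, hcp]; field_simp
      rw [h]
      refine div_le_div_of_nonneg_right ?_ hn.le
      have := mul_le_mul hX1 hWWP hQ0 zero_le_one
      linarith [hWP 2]
    have h3 := mul_le_mul_of_nonneg_right h2 hπ
    constructor <;> linarith
  have hsq : E.uRIG.card ^ 2 * (E.wRIG.card ^ 2 * p ^ 4 + E.wRIG.card * p ^ 3) +
      E.uRIG.card * (E.wRIG.card * p ^ 2) ≤ (b ^ 2 * Γ ^ 4 + b * Γ ^ 3) + b * Γ ^ 2 := by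
    have h : E.uRIG.card ^ 2 * (E.wRIG.card ^ 2 * p ^ 4 + E.wRIG.card * p ^ 3) +
      E.uRIG.card * (E.wRIG.card * p ^ 2) =
        X ^ 2 * (W ^ 2 * P ^ 4 + W * P ^ 3) + X * (W * P ^ 2) := by
      rw [hcX, hcW, hcp]; field_simp
    rw [h]
    have h1 := mul_le_mul (pow_le_one₀ hX0 hX1 (n := 2)) hWWP hQ0 zero_le_one
    have h2 := mul_le_mul hX1 (hWP 2) (by positivity) zero_le_one
    linarith
  have hsq' : (E.wRIG.card * p) ^ 2 + E.wRIG.card * p ≤ (b * Γ) ^ 2 + b * Γ := by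
    have h : (E.wRIG.card * p : ℝ) = W * P := by rw [hcW, hcp]; field_simp
    rw [h]
    gcongr
  have hterm1 : (-(2 / n * e₁)) * ∑ A, μ A * blocked A E.uRIG v ≤
      (-(2 / n * e₁)) * (E.uRIG.card * (E.wRIG.card * p ^ 2) * π) +
        2 * (G * (b * Γ ^ 2 + (b ^ 2 * Γ ^ 4 + b * Γ ^ 3))) / n ^ 2 * π := by
    have h1 : |(-(2 / n * e₁)) * (∑ A, μ A * blocked A E.uRIG v -
        E.uRIG.card * (E.wRIG.card * p ^ 2) * π)| ≤
        (2 / n * G) * ((b * Γ ^ 2 + (b ^ 2 * Γ ^ 4 + b * Γ ^ 3)) / n * π) := by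
      rw [abs_mul, abs_neg, abs_mul, abs_of_pos (by positivity : 0 < 2 / n)]
      gcongr
    have h2 := (le_abs_self _).trans h1
    have h3 : (2 / n * G) * ((b * Γ ^ 2 + (b ^ 2 * Γ ^ 4 + b * Γ ^ 3)) / n * π) =
        2 * (G * (b * Γ ^ 2 + (b ^ 2 * Γ ^ 4 + b * Γ ^ 3))) / n ^ 2 * π := by
      field_simp
    rw [mul_sub, h3] at h2
    linarith
  have hterm2 := mul_le_mul_of_nonneg_left (hB3.trans (mul_le_mul_of_nonneg_right hsq hπ))
    (by positivity : 0 ≤ 2 / n ^ 2)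
  have hterm3 := mul_le_mul_of_nonneg_left (hJ2.trans (mul_le_mul_of_nonneg_right hsq' hπ))
    (by positivity : 0 ≤ 1 / n ^ 2)
  refine (add_le_add (add_le_add (add_le_add (add_le_add le_rfl hterm1) hterm2) le_rfl)
    hterm3).trans_eq ?_
  rw [sqDist, ← he₁, ← he₂, ← he₃, stepError]
  ring

theorem sqDist_excite_inr {n g₁ g₂ g₃ : ℝ} (A : Incidence N m) (E : State N m K) {v : Fin K}
    (hv : v ∈ E.u0DRIG) :
    sqDist n g₁ g₂ g₃ (excite A E (Sum.inr v)) =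
      sqDist n g₁ g₂ g₃ E - 2 / n * (E.u0DRIG.card / n - g₂) + 1 / n ^ 2 := by
  have h : ((E.u0DRIG.erase v).card : ℝ) + 1 = E.u0DRIG.card := by
    exact_mod_cast Finset.card_erase_add_one hv
  simp only [sqDist, excite, ← h]
  ring

theorem sum_stepPMF_mul (A : Incidence N m) (E : State N m K) (h : State N m K → ℝ) :
    ∑ E', (stepPMF A E E').toReal * h E' =
      if E.numUnaffected = 0 then h E else
        (∑ v ∈ E.uRIG, h (excite A E (Sum.inl v)) +
          ∑ v ∈ E.u0DRIG, h (excite A E (Sum.inr v))) / E.numUnaffected := by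
  have hcard : E.unaffected.card = E.numUnaffected := by
    simp [State.unaffected, State.numUnaffected, Finset.card_disjSum]
  unfold stepPMF
  split_ifs with h1 h2 h2
  · rw [← hcard, Finset.card_eq_zero] at h2
    simp [h2] at h1
  · rw [pmf_sum_map, pmf_sum_uniformOfFinset, hcard, State.unaffected, Finset.sum_disjSum]
  · rw [pmf_sum_pure]
  · rw [Finset.not_nonempty_iff_eq_empty] at h1
    rw [← hcard, h1] at h2
    simp at h2

/-- The expected squared distance to a point after one iteration. -/
theorem IsBlockLaw.sum_step_le {p n g₁ g₂ g₃ G b Γ : ℝ} {E : State N m K}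
    {μ : Incidence N m → ℝ} (hμ : IsBlockLaw p E.uRIG E.wRIG μ) (hp : 0 ≤ p) (hn : 0 < n)
    (hu : E.uRIG.card ≤ n) (hw : E.wRIG.card ≤ b * n) (hΓ : p * n ≤ Γ) (hb : 0 ≤ b)
    (hG : |E.uRIG.card / n - g₁| ≤ G) :
    ∑ A, μ A * ∑ E', (stepPMF A E E').toReal * sqDist n g₁ g₂ g₃ E' ≤
      (sqDist n g₁ g₂ g₃ E -
        2 / n * (E.uRIG.card / (E.uRIG.card + E.u0DRIG.card) *
          ((E.uRIG.card / n - g₁) * (1 + E.uRIG.card * (E.wRIG.card * p ^ 2)) +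
            (E.wRIG.card / n - g₃) * (E.wRIG.card * p)) +
          E.u0DRIG.card / (E.uRIG.card + E.u0DRIG.card) * (E.u0DRIG.card / n - g₂)) +
        stepError G b Γ / n ^ 2) * ∑ A, μ A := by
  have hπ : 0 ≤ ∑ A, μ A := Finset.sum_nonneg fun A _ => hμ.nonneg A
  have hG0 : 0 ≤ G := (abs_nonneg _).trans hG
  have hΓ0 : 0 ≤ Γ := (mul_nonneg hp hn.le).trans hΓ
  have hC := one_le_stepError hG0 hb hΓ0
  simp only [sum_stepPMF_mul]
  -- In the idle case both shares are `0 / 0 = 0`, so the drift term disappears and the nonnegative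
  -- error term suffices.
  by_cases h0 : E.numUnaffected = 0
  · simp only [h0, if_true]
    have h1 : E.uRIG.card = 0 ∧ E.u0DRIG.card = 0 := by
      simpa [State.numUnaffected] using h0
    rw [← Finset.sum_mul, mul_comm, h1.1, h1.2]
    refine mul_le_mul_of_nonneg_right ?_ hπ
    have : 0 ≤ stepError G b Γ / n ^ 2 := by positivity
    simp only [Nat.cast_zero, zero_div, zero_mul, add_zero, mul_zero, sub_zero]
    linarith
  · simp only [h0, if_false]
    have hU : (0 : ℝ) < E.uRIG.card + E.u0DRIG.card := by
      have : 0 < E.numUnaffected := Nat.pos_of_ne_zero h0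
      unfold State.numUnaffected at this
      exact_mod_cast this
    have hUc : (E.numUnaffected : ℝ) = E.uRIG.card + E.u0DRIG.card := by
      simp [State.numUnaffected]
    have hsplit : ∑ A, μ A * ((∑ v ∈ E.uRIG, sqDist n g₁ g₂ g₃ (excite A E (Sum.inl v)) +
        ∑ v ∈ E.u0DRIG, sqDist n g₁ g₂ g₃ (excite A E (Sum.inr v))) / E.numUnaffected) =
        (∑ v ∈ E.uRIG, ∑ A, μ A * sqDist n g₁ g₂ g₃ (excite A E (Sum.inl v)) +
          ∑ v ∈ E.u0DRIG, ∑ A, μ A * sqDist n g₁ g₂ g₃ (excite A E (Sum.inr v))) /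
          E.numUnaffected := by
      rw [Finset.sum_comm (s := E.uRIG), Finset.sum_comm (s := E.u0DRIG),
        ← Finset.sum_add_distrib, Finset.sum_div]
      refine Finset.sum_congr rfl fun A _ => ?_
      rw [← Finset.mul_sum, ← Finset.mul_sum]
      ring
    rw [hsplit, hUc, div_le_iff₀ hU]
    have hI := Finset.sum_le_sum fun v hv =>
      hμ.sum_excite_inl_le (g₂ := g₂) (g₃ := g₃) hp hn hu hw hΓ hb hG (v := v) hv
    have hII : ∑ v ∈ E.u0DRIG, ∑ A, μ A * sqDist n g₁ g₂ g₃ (excite A E (Sum.inr v)) ≤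
        ∑ v ∈ E.u0DRIG, (sqDist n g₁ g₂ g₃ E - 2 / n * (E.u0DRIG.card / n - g₂) +
          stepError G b Γ / n ^ 2) * ∑ A, μ A := by
      refine Finset.sum_le_sum fun v hv => ?_
      rw [Finset.sum_congr rfl fun A _ => by rw [sqDist_excite_inr A E hv], ← Finset.sum_mul,
        mul_comm]
      refine mul_le_mul_of_nonneg_right ?_ hπ
      have := div_le_div_of_nonneg_right hC (by positivity : 0 ≤ n ^ 2)
      linarith
    refine (add_le_add hI hII).trans_eq ?_
    rw [Finset.sum_const, Finset.sum_const, nsmul_eq_mul, nsmul_eq_mul]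
    field_simp
    ring

/-! ### The mean squared distance to the fluid limit -/

/-- The mean squared distance, after `t` iterations, of the scaled numbers of unaffected vertices
and attributes to a given point. -/
def meanSqDist (N m K : ℕ) (p : ℝ) (t : ℕ) (n g₁ g₂ g₃ : ℝ) : ℝ :=
  ∑ E : State N m K, (∑ A, jointMass p t E A) * sqDist n g₁ g₂ g₃ E

theorem sum_jointMass_succ (p : ℝ) (t : ℕ) (h : State N m K → ℝ) :
    ∑ E, (∑ A, jointMass p (t + 1) E A) * h E =
      ∑ E, ∑ A, jointMass p t E A * ∑ E', (stepPMF A E E').toReal * h E' := by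
  simp only [Finset.sum_mul]
  rw [Finset.sum_comm, Finset.sum_comm (t := (Finset.univ : Finset (Incidence N m)))
    (s := (Finset.univ : Finset (State N m K)))]
  refine Finset.sum_congr rfl fun A _ => ?_
  simp only [jointMass, mul_assoc, ← Finset.mul_sum]
  rw [chainLaw, pmf_sum_bind]

theorem sum_incidence_realWeight {p : ℝ≥0∞} (hp : p ≤ 1) :
    ∑ A : Incidence N m, realWeight p.toReal A = 1 := by
  rw [← pmf_sum_toReal (incidencePMF N m p hp)]
  exact Finset.sum_congr rfl fun A _ => (incidencePMF_toReal hp A).symm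

theorem sum_jointMass {p : ℝ≥0∞} (hp : p ≤ 1) (t : ℕ) :
    ∑ E : State N m K, ∑ A, jointMass p.toReal t E A = 1 := by
  rw [Finset.sum_comm, ← sum_incidence_realWeight (N := N) (m := m) hp]
  refine Finset.sum_congr rfl fun A _ => ?_
  simp only [jointMass]
  rw [← Finset.mul_sum, pmf_sum_toReal, mul_one]

theorem meanSqDist_zero {p : ℝ≥0∞} (hp : p ≤ 1) (n g₁ g₂ g₃ : ℝ) :
    meanSqDist N m K p.toReal 0 n g₁ g₂ g₃ =
      (N / n - g₁) ^ 2 + (K / n - g₂) ^ 2 + (m / n - g₃) ^ 2 := by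
  have h : meanSqDist N m K p.toReal 0 n g₁ g₂ g₃ =
      ∑ A : Incidence N m, realWeight p.toReal A *
        ∑ E : State N m K, (chainLaw A 0 E).toReal * sqDist n g₁ g₂ g₃ E := by
    simp only [meanSqDist, jointMass, Finset.sum_mul, Finset.mul_sum]
    rw [Finset.sum_comm]
    simp only [mul_assoc]
  rw [h]
  simp only [chainLaw, pmf_sum_pure]
  rw [← Finset.sum_mul, sum_incidence_realWeight hp]
  simp [sqDist, State.init]

/-- The law of the state after `t` iterations. -/
def stateLaw (N m K : ℕ) (p : ℝ≥0∞) (hp : p ≤ 1) (t : ℕ) : PMF (State N m K) :=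
  (incidencePMF N m p hp).bind fun A => chainLaw A t

theorem stateLaw_toReal {p : ℝ≥0∞} (hp : p ≤ 1) (t : ℕ) (E : State N m K) :
    (stateLaw N m K p hp t E).toReal = ∑ A, jointMass p.toReal t E A := by
  rw [stateLaw, pmf_bind_toReal]
  simp only [jointMass, incidencePMF_toReal]

/-- Chebyshev's inequality for the scaled number of unaffected vertices. -/
theorem stateLaw_deviation_le {p : ℝ≥0∞} (hp : p ≤ 1) (t : ℕ) (n g₁ g₂ g₃ : ℝ) {η : ℝ}
    (hη : 0 < η) :
    (stateLaw N m K p hp t).toOuterMeasure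
      {E | η < |(E.numUnaffected : ℝ) / n - (g₁ + g₂)|} ≤
      ENNReal.ofReal (2 / η ^ 2 * meanSqDist N m K p.toReal t n g₁ g₂ g₃) := by
  classical
  rw [PMF.toOuterMeasure_apply_fintype, meanSqDist, Finset.mul_sum,
    ENNReal.ofReal_sum_of_nonneg]
  · refine Finset.sum_le_sum fun E _ => ?_
    rw [← stateLaw_toReal hp]
    by_cases hE : η < |(E.numUnaffected : ℝ) / n - (g₁ + g₂)|
    · simp only [Set.indicator_apply, Set.mem_ofPred_eq, hE, if_true]
      rw [← ENNReal.ofReal_toReal ((stateLaw N m K p hp t).apply_ne_top E)]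
      refine ENNReal.ofReal_le_ofReal ?_
      rw [ENNReal.toReal_ofReal ENNReal.toReal_nonneg]
      -- From `(a + b) ^ 2 ≤ 2 * (a ^ 2 + b ^ 2)` applied to the two kinds of vertices.
      have h1 : η ^ 2 ≤ 2 * sqDist n g₁ g₂ g₃ E := by
        have h2 : η ^ 2 ≤ ((E.numUnaffected : ℝ) / n - (g₁ + g₂)) ^ 2 := by
          rw [← sq_abs ((E.numUnaffected : ℝ) / n - (g₁ + g₂))]
          exact pow_le_pow_left₀ hη.le hE.le 2
        have h3 : (E.numUnaffected : ℝ) / n - (g₁ + g₂) =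
            (E.uRIG.card / n - g₁) + (E.u0DRIG.card / n - g₂) := by
          simp only [State.numUnaffected, Nat.cast_add]; ring
        rw [h3] at h2
        rw [sqDist]
        nlinarith [sq_nonneg ((E.uRIG.card / n - g₁) - (E.u0DRIG.card / n - g₂)),
          sq_nonneg (E.wRIG.card / n - g₃)]
      have h4 : 1 ≤ 2 / η ^ 2 * sqDist n g₁ g₂ g₃ E := by
        rw [div_mul_eq_mul_div, one_le_div (by positivity)]; exact h1
      calc (stateLaw N m K p hp t E).toReal
          = (stateLaw N m K p hp t E).toReal * 1 := (mul_one _).symm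
        _ ≤ (stateLaw N m K p hp t E).toReal * (2 / η ^ 2 * sqDist n g₁ g₂ g₃ E) :=
          mul_le_mul_of_nonneg_left h4 ENNReal.toReal_nonneg
        _ = _ := by ring
    · simp only [Set.indicator_apply, Set.mem_ofPred_eq, hE, if_false]
      exact zero_le
  · intro E _
    rw [← stateLaw_toReal hp]
    have : 0 ≤ sqDist n g₁ g₂ g₃ E := by unfold sqDist; positivity
    exact mul_nonneg (by positivity) (mul_nonneg ENNReal.toReal_nonneg this)

/-! ### Deterministic estimates -/

/-- Only the fluid denominator must be bounded below. The random share lies in `[0, 1]` whatever its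
denominator, including the value zero, so no a priori control of the process is needed. -/
theorem abs_share_sub_le {x₁ x₂ f₁ f₂ δ : ℝ} (h1 : 0 ≤ x₁) (h2 : 0 ≤ x₂) (hδ : 0 < δ)
    (hf : δ ≤ f₁ + f₂) :
    |x₁ / (x₁ + x₂) - f₁ / (f₁ + f₂)| ≤ 2 / δ * (|x₁ - f₁| + |x₂ - f₂|) := by
  have hF : 0 < f₁ + f₂ := hδ.trans_le hf
  have hr : |x₁ / (x₁ + x₂)| ≤ 1 := by
    rw [abs_of_nonneg (by positivity)]
    exact div_le_one_of_le₀ (by linarith) (by linarith)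
  have h : x₁ / (x₁ + x₂) - f₁ / (f₁ + f₂) =
      (x₁ / (x₁ + x₂) * (-((x₁ - f₁) + (x₂ - f₂))) + (x₁ - f₁)) / (f₁ + f₂) := by
    rcases eq_or_lt_of_le (add_nonneg h1 h2) with h0 | h0
    · have : x₁ = 0 := by linarith
      have : x₂ = 0 := by linarith
      subst_vars
      simp
      ring
    · field_simp
      ring
  rw [h, abs_div, abs_of_pos hF, div_mul_eq_mul_div 2 δ]
  refine div_le_div₀ (by positivity) ?_ hδ hf
  have h3 := abs_add_le (x₁ / (x₁ + x₂) * (-((x₁ - f₁) + (x₂ - f₂)))) (x₁ - f₁)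
  have h4 : |x₁ / (x₁ + x₂) * (-((x₁ - f₁) + (x₂ - f₂)))| ≤ |x₁ - f₁| + |x₂ - f₂| := by
    rw [abs_mul, abs_neg]
    calc _ ≤ 1 * |(x₁ - f₁) + (x₂ - f₂)| := mul_le_mul_of_nonneg_right hr (abs_nonneg _)
      _ ≤ _ := by rw [one_mul]; exact abs_add_le _ _
  linarith [abs_nonneg (x₂ - f₂)]

/-- Here `d` is the current error, `Δ` the fluid increment, close to `-h / n`, and `B` the drift of
the process. The first-order terms combine into `d * (Δ + B / n)`, which sees only the discrepancy
`B - h` and the expansion error. -/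
theorem sq_increment_le {n d Δ B h ℓD η H : ℝ} (hn : 0 < n)
    (h1 : |Δ + h / n| ≤ η / n) (h2 : |B - h| ≤ ℓD + η) (h3 : |Δ| ≤ H / n) (h4 : |B| ≤ H) :
    (d - Δ) ^ 2 - 2 / n * ((d - Δ) * B) ≤
      d ^ 2 + 2 / n * (|d| * (2 * η + ℓD)) + 3 * H ^ 2 / n ^ 2 := by
  have hH : 0 ≤ H := (abs_nonneg _).trans h4
  have e1 : |Δ + B / n| ≤ (2 * η + ℓD) / n := by
    have : Δ + B / n = (Δ + h / n) + (B - h) / n := by ring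
    rw [this]
    refine (abs_add_le _ _).trans ?_
    rw [abs_div (B - h), abs_of_pos hn]
    have := div_le_div_of_nonneg_right h2 hn.le
    refine (add_le_add h1 this).trans_eq (by ring)
  have e2 : -(2 * d * (Δ + B / n)) ≤ 2 / n * (|d| * (2 * η + ℓD)) := by
    have := mul_le_mul_of_nonneg_left e1 (abs_nonneg (2 * d))
    rw [← abs_mul, abs_mul 2 d, abs_two] at this
    refine (neg_le_abs _).trans (this.trans_eq (by ring))
  have e3 : Δ ^ 2 ≤ H ^ 2 / n ^ 2 := by
    rw [← sq_abs, ← div_pow]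
    exact pow_le_pow_left₀ (abs_nonneg _) h3 2
  have e4 : 2 / n * (Δ * B) ≤ 2 * H ^ 2 / n ^ 2 := by
    have : Δ * B ≤ H / n * H := (le_abs_self _).trans (by
      rw [abs_mul]; exact mul_le_mul h3 h4 (abs_nonneg _) (by positivity))
    refine (mul_le_mul_of_nonneg_left this (by positivity)).trans_eq (by ring)
  have e5 : (d - Δ) ^ 2 - 2 / n * ((d - Δ) * B) =
      d ^ 2 + -(2 * d * (Δ + B / n)) + Δ ^ 2 + 2 / n * (Δ * B) := by ring
  rw [e5]
  have e6 : 3 * H ^ 2 / n ^ 2 = H ^ 2 / n ^ 2 + 2 * H ^ 2 / n ^ 2 := by ring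
  linarith

theorem sq_increments_le {n d₁ d₂ d₃ Δ₁ Δ₂ Δ₃ B₁ B₂ B₃ h₁ h₂ h₃ ℓ η H : ℝ} (hn : 0 < n)
    (hη : 0 ≤ η) (hη1 : η ≤ 1) (hℓ : 0 ≤ ℓ)
    (hΔ₁ : |Δ₁ + h₁ / n| ≤ η / n) (hΔ₂ : |Δ₂ + h₂ / n| ≤ η / n) (hΔ₃ : |Δ₃ + h₃ / n| ≤ η / n)
    (hB₁ : |B₁ - h₁| ≤ ℓ * (|d₁| + |d₂| + |d₃|) + η)
    (hB₂ : |B₂ - h₂| ≤ ℓ * (|d₁| + |d₂| + |d₃|) + η)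
    (hB₃ : |B₃ - h₃| ≤ ℓ * (|d₁| + |d₂| + |d₃|) + η)
    (hD₁ : |Δ₁| ≤ H / n) (hD₂ : |Δ₂| ≤ H / n) (hD₃ : |Δ₃| ≤ H / n)
    (hH₁ : |B₁| ≤ H) (hH₂ : |B₂| ≤ H) (hH₃ : |B₃| ≤ H) :
    (d₁ - Δ₁) ^ 2 + (d₂ - Δ₂) ^ 2 + (d₃ - Δ₃) ^ 2 -
      2 / n * ((d₁ - Δ₁) * B₁ + (d₂ - Δ₂) * B₂ + (d₃ - Δ₃) * B₃) ≤
      (1 + (6 * ℓ + 2) / n) * (d₁ ^ 2 + d₂ ^ 2 + d₃ ^ 2) + 6 * η / n + 9 * H ^ 2 / n ^ 2 := by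
  have k1 := sq_increment_le (d := d₁) hn hΔ₁ hB₁ hD₁ hH₁
  have k2 := sq_increment_le (d := d₂) hn hΔ₂ hB₂ hD₂ hH₂
  have k3 := sq_increment_le (d := d₃) hn hΔ₃ hB₃ hD₃ hH₃
  have k4 : (|d₁| + |d₂| + |d₃|) * (2 * η + ℓ * (|d₁| + |d₂| + |d₃|)) ≤
      (3 * ℓ + 1) * (d₁ ^ 2 + d₂ ^ 2 + d₃ ^ 2) + 3 * η := by
    rw [← sq_abs d₁, ← sq_abs d₂, ← sq_abs d₃]
    generalize |d₁| = a
    generalize |d₂| = b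
    generalize |d₃| = c
    have q1 : (a + b + c) ^ 2 ≤ 3 * (a ^ 2 + b ^ 2 + c ^ 2) := by
      nlinarith [sq_nonneg (a - b), sq_nonneg (b - c), sq_nonneg (a - c)]
    have q2 := mul_le_mul_of_nonneg_left q1 hℓ
    have q3 : 2 * (a + b + c) ≤ 3 + (a ^ 2 + b ^ 2 + c ^ 2) := by
      nlinarith [sq_nonneg (a - 1), sq_nonneg (b - 1), sq_nonneg (c - 1)]
    -- The terms linear in the errors are absorbed into the squares at the price of a constant
    -- multiple of `η`, as Gronwall requires.
    have q4 := mul_le_mul_of_nonneg_left q3 hη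
    have q5 : η * (a ^ 2 + b ^ 2 + c ^ 2) ≤ 1 * (a ^ 2 + b ^ 2 + c ^ 2) :=
      mul_le_mul_of_nonneg_right hη1 (by positivity)
    have q6 : (a + b + c) * (2 * η + ℓ * (a + b + c)) =
        η * (2 * (a + b + c)) + ℓ * (a + b + c) ^ 2 := by ring
    rw [q6]
    linarith
  have k5 := mul_le_mul_of_nonneg_left k4 (by positivity : 0 ≤ 2 / n)
  have k6 : 2 / n * ((3 * ℓ + 1) * (d₁ ^ 2 + d₂ ^ 2 + d₃ ^ 2) + 3 * η) =
      (6 * ℓ + 2) / n * (d₁ ^ 2 + d₂ ^ 2 + d₃ ^ 2) + 6 * η / n := by ring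
  have k7 : 2 / n * ((|d₁| + |d₂| + |d₃|) * (2 * η + ℓ * (|d₁| + |d₂| + |d₃|))) =
      2 / n * (|d₁| * (2 * η + ℓ * (|d₁| + |d₂| + |d₃|))) +
      2 / n * (|d₂| * (2 * η + ℓ * (|d₁| + |d₂| + |d₃|))) +
      2 / n * (|d₃| * (2 * η + ℓ * (|d₁| + |d₂| + |d₃|))) := by ring
  have k8 : 9 * H ^ 2 / n ^ 2 = 3 * (3 * H ^ 2 / n ^ 2) := by ring
  rw [k8]
  linarith

/-- Iteration gives the factor `(1 + L / n) ^ t`, at most `exp (L * t / n)`, and `t / n ≤ S`. -/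
theorem discrete_gronwall {a : ℕ → ℝ} {L ε n : ℝ} (hn : 0 < n) (hL : 0 ≤ L) (hε : 0 ≤ ε)
    {S : ℝ} {T : ℕ} (hT : T ≤ S * n) (ha0 : 0 ≤ a 0)
    (h : ∀ t, t < T → a (t + 1) ≤ (1 + L / n) * a t + ε / n) :
    ∀ t ≤ T, a t ≤ Real.exp (L * S) * (a 0 + ε * S) := by
  have hq : 1 ≤ 1 + L / n := by have := div_nonneg hL hn.le; linarith
  have key : ∀ t ≤ T, a t ≤ (1 + L / n) ^ t * (a 0 + t * (ε / n)) := by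
    intro t
    induction t with
    | zero => simp
    | succ t ih =>
      intro ht
      have h1 := ih (by omega)
      have h2 := mul_le_mul_of_nonneg_left h1 (zero_le_one.trans hq)
      have h3 : ε / n ≤ (1 + L / n) ^ (t + 1) * (ε / n) :=
        le_mul_of_one_le_left (by positivity) (one_le_pow₀ hq)
      refine (h t (by omega)).trans ((add_le_add h2 h3).trans_eq ?_)
      push_cast
      ring
  intro t ht
  have htS : (t : ℝ) / n ≤ S := by
    rw [div_le_iff₀ hn]
    exact (Nat.cast_le.2 ht).trans hT
  refine (key t ht).trans ?_
  refine mul_le_mul ?_ ?_ (by positivity) (Real.exp_pos _).le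
  · calc (1 + L / n) ^ t ≤ Real.exp (L / n) ^ t := by
          refine pow_le_pow_left₀ (by positivity) ?_ t
          rw [add_comm]; exact Real.add_one_le_exp _
      _ = Real.exp (L * (t / n)) := by rw [← Real.exp_nat_mul]; congr 1; ring
      _ ≤ _ := Real.exp_le_exp.2 (mul_le_mul_of_nonneg_left htS hL)
  · have : t * (ε / n) = ε * (t / n) := by ring
    rw [this]
    linarith [mul_le_mul_of_nonneg_left htS hε]

/-- First-order expansion of a primitive, uniformly on a compact interval. -/
theorem exists_uniform_expansion {f h : ℝ → ℝ} {f₀ S : ℝ} (hc : ContinuousOn h (Set.Icc 0 S))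
    (hf : ∀ s ∈ Set.Icc 0 S, f s = f₀ - ∫ y in (0 : ℝ)..s, h y) {η : ℝ} (hη : 0 < η) :
    ∃ δ > 0, ∀ s ∈ Set.Icc 0 S, ∀ s' ∈ Set.Icc 0 S, s ≤ s' → s' - s ≤ δ →
      |(f s' - f s) + h s * (s' - s)| ≤ η * (s' - s) := by
  have hu := isCompact_Icc.uniformContinuousOn_of_continuous hc
  obtain ⟨δ, hδ, hδ'⟩ := Metric.uniformContinuousOn_iff_le.1 hu η hη
  refine ⟨δ, hδ, fun s hs s' hs' hss hsd => ?_⟩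
  have hi : ∀ {a b : ℝ}, a ∈ Set.Icc 0 S → b ∈ Set.Icc 0 S →
      IntervalIntegrable h MeasureTheory.volume a b := fun ha hb =>
    (hc.mono (Set.uIcc_subset_Icc ha hb)).intervalIntegrable
  have h0 : (0 : ℝ) ∈ Set.Icc 0 S := ⟨le_rfl, hs.1.trans hs.2⟩
  have h1 : f s' - f s = -∫ y in s..s', h y := by
    rw [hf s hs, hf s' hs', ← intervalIntegral.integral_add_adjacent_intervals (hi h0 hs)
      (hi hs hs')]
    ring
  have h2 : (f s' - f s) + h s * (s' - s) = ∫ y in s..s', (h s - h y) := by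
    rw [intervalIntegral.integral_sub intervalIntegrable_const (hi hs hs'), h1]
    simp
    ring
  rw [h2, ← Real.norm_eq_abs, ← abs_of_nonneg (sub_nonneg.2 hss)]
  refine intervalIntegral.norm_integral_le_of_norm_le_const fun y hy => ?_
  rw [Set.uIoc_of_le hss] at hy
  have hyS : y ∈ Set.Icc 0 S := ⟨hs.1.trans hy.1.le, hy.2.trans hs'.2⟩
  have := hδ' s hs y hyS (by
    rw [Real.dist_eq, abs_sub_comm, abs_of_nonneg (by linarith [hy.1])]
    linarith [hy.2])
  rwa [Real.dist_eq] at this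

/-- A Lipschitz constant of the drift near a point with sum of the first two coordinates at least
`δ` and with coordinates bounded by `Q`. -/
def driftLip (δ Q g : ℝ) : ℝ :=
  2 / δ * (1 + g ^ 2 * Q ^ 2 + g * Q) + g ^ 2 * (1 + Q) + g

theorem driftLip_nonneg {δ Q g : ℝ} (hδ : 0 < δ) (hQ : 0 ≤ Q) (hg : 0 ≤ g) :
    0 ≤ driftLip δ Q g := by
  unfold driftLip; positivity

theorem share_mem_Icc {x y : ℝ} (hx : 0 ≤ x) (hy : 0 ≤ y) : x / (x + y) ∈ Set.Icc (0 : ℝ) 1 :=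
  ⟨by positivity, div_le_one_of_le₀ (by linarith) (by linarith)⟩

/-- The `x` are the scaled random counts and `κ` is `p * n`; the `f` and `g` are their limits. Each
difference is telescoped into a change of share, of parameter and of coordinates. -/
theorem abs_drift_sub_le {x₁ x₂ x₃ f₁ f₂ f₃ δ Q g κ b : ℝ} (hx₁ : 0 ≤ x₁) (hx₁' : x₁ ≤ 1)
    (hx₂ : 0 ≤ x₂) (hx₃ : 0 ≤ x₃) (hx₃' : x₃ ≤ b) (hδ : 0 < δ) (hf : δ ≤ f₁ + f₂)
    (hQ₁ : |f₁| ≤ Q) (hQ₃ : |f₃| ≤ Q) (hg : 0 ≤ g) :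
    |x₁ / (x₁ + x₂) * (1 + κ ^ 2 * x₁ * x₃) - f₁ / (f₁ + f₂) * (1 + g ^ 2 * f₁ * f₃)| ≤
        driftLip δ Q g * (|x₁ - f₁| + |x₂ - f₂| + |x₃ - f₃|) + |κ ^ 2 - g ^ 2| * b ∧
      |x₂ / (x₁ + x₂) - f₂ / (f₁ + f₂)| ≤
        driftLip δ Q g * (|x₁ - f₁| + |x₂ - f₂| + |x₃ - f₃|) ∧
      |x₁ / (x₁ + x₂) * (κ * x₃) - f₁ / (f₁ + f₂) * (g * f₃)| ≤
        driftLip δ Q g * (|x₁ - f₁| + |x₂ - f₂| + |x₃ - f₃|) + |κ - g| * b := by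
  have hQ : 0 ≤ Q := (abs_nonneg _).trans hQ₁
  have hs1 := abs_share_sub_le hx₁ hx₂ hδ hf
  have hs2 := abs_share_sub_le hx₂ hx₁ hδ (by rwa [add_comm] at hf)
  rw [add_comm x₂ x₁, add_comm f₂ f₁] at hs2
  obtain ⟨hr0, hr1⟩ := share_mem_Icc hx₁ hx₂
  have hr : |x₁ / (x₁ + x₂)| ≤ 1 := by rw [abs_of_nonneg hr0]; exact hr1
  set r := x₁ / (x₁ + x₂)
  set r' := f₁ / (f₁ + f₂)
  set D := |x₁ - f₁| + |x₂ - f₂| + |x₃ - f₃| with hD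
  have hd1 := abs_nonneg (x₁ - f₁)
  have hd2 := abs_nonneg (x₂ - f₂)
  have hd3 := abs_nonneg (x₃ - f₃)
  have hD0 : 0 ≤ D := by positivity
  have h2δ : 0 ≤ 2 / δ := by positivity
  have hrD : |r - r'| ≤ 2 / δ * D :=
    hs1.trans (mul_le_mul_of_nonneg_left (by linarith) h2δ)
  have hlip : driftLip δ Q g * D = 2 / δ * D * (1 + g ^ 2 * Q ^ 2) + 2 / δ * D * (g * Q) +
      g ^ 2 * ((1 + Q) * D) + g * D := by unfold driftLip; ring
  have hp1 : 0 ≤ 2 / δ * D * (1 + g ^ 2 * Q ^ 2) := by positivity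
  have hp2 : 0 ≤ 2 / δ * D * (g * Q) := by positivity
  have hp3 : 0 ≤ g ^ 2 * ((1 + Q) * D) := by positivity
  have hp4 : 0 ≤ g * D := by positivity
  refine ⟨?_, ?_, ?_⟩
  · have e : r * (1 + κ ^ 2 * x₁ * x₃) - r' * (1 + g ^ 2 * f₁ * f₃) =
        (r - r') * (1 + g ^ 2 * f₁ * f₃) + r * ((κ ^ 2 - g ^ 2) * (x₁ * x₃)) +
          r * (g ^ 2 * (x₁ * (x₃ - f₃) + f₃ * (x₁ - f₁))) := by ring
    have t1 : |(r - r') * (1 + g ^ 2 * f₁ * f₃)| ≤ 2 / δ * D * (1 + g ^ 2 * Q ^ 2) := by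
      rw [abs_mul]
      refine mul_le_mul hrD ?_ (abs_nonneg _) (by positivity)
      refine (abs_add_le _ _).trans ?_
      rw [abs_one, abs_mul, abs_mul, abs_of_nonneg (sq_nonneg g), mul_assoc, sq Q]
      gcongr
    have t2 : |r * ((κ ^ 2 - g ^ 2) * (x₁ * x₃))| ≤ |κ ^ 2 - g ^ 2| * b := by
      rw [abs_mul, abs_mul, abs_of_nonneg (mul_nonneg hx₁ hx₃)]
      have h1 : x₁ * x₃ ≤ b := (mul_le_of_le_one_left hx₃ hx₁').trans hx₃'
      exact (mul_le_of_le_one_left (by positivity) hr).trans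
        (mul_le_mul_of_nonneg_left h1 (abs_nonneg _))
    have t3 : |r * (g ^ 2 * (x₁ * (x₃ - f₃) + f₃ * (x₁ - f₁)))| ≤ g ^ 2 * ((1 + Q) * D) := by
      rw [abs_mul, abs_mul, abs_of_nonneg (sq_nonneg g)]
      refine (mul_le_of_le_one_left (by positivity) hr).trans
        (mul_le_mul_of_nonneg_left ?_ (sq_nonneg g))
      refine (abs_add_le _ _).trans ?_
      rw [abs_mul, abs_mul, abs_of_nonneg hx₁]
      have h1 : x₁ * |x₃ - f₃| ≤ 1 * D := mul_le_mul hx₁' (by linarith) hd3 zero_le_one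
      have h2 : |f₃| * |x₁ - f₁| ≤ Q * D := mul_le_mul hQ₃ (by linarith) hd1 hQ
      linarith
    rw [e, hlip]
    refine (abs_add_three _ _ _).trans ?_
    linarith
  · refine hs2.trans ?_
    rw [hlip]
    have h1 : 2 / δ * (|x₂ - f₂| + |x₁ - f₁|) ≤ 2 / δ * D :=
      mul_le_mul_of_nonneg_left (by linarith) h2δ
    have h2 : 2 / δ * D ≤ 2 / δ * D * (1 + g ^ 2 * Q ^ 2) :=
      le_mul_of_one_le_right (by positivity) (by nlinarith [mul_nonneg (sq_nonneg g) (sq_nonneg Q)])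
    linarith
  · have e : r * (κ * x₃) - r' * (g * f₃) =
        (r - r') * (g * f₃) + r * ((κ - g) * x₃) + r * (g * (x₃ - f₃)) := by ring
    have t1 : |(r - r') * (g * f₃)| ≤ 2 / δ * D * (g * Q) := by
      rw [abs_mul, abs_mul, abs_of_nonneg hg]
      gcongr
    have t2 : |r * ((κ - g) * x₃)| ≤ |κ - g| * b := by
      rw [abs_mul, abs_mul, abs_of_nonneg hx₃]
      exact (mul_le_of_le_one_left (by positivity) hr).trans
        (mul_le_mul_of_nonneg_left hx₃' (abs_nonneg _))
    have t3 : |r * (g * (x₃ - f₃))| ≤ g * D := by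
      rw [abs_mul, abs_mul, abs_of_nonneg hg]
      exact (mul_le_of_le_one_left (by positivity) hr).trans
        (mul_le_mul_of_nonneg_left (by linarith) hg)
    rw [e, hlip]
    refine (abs_add_three _ _ _).trans ?_
    linarith

/-- One step of the recursion for the mean squared distance to the fluid limit. -/
theorem meanSqDist_succ_le {p : ℝ≥0∞} (hp : p ≤ 1) (t : ℕ)
    {n b g Γ δ Q H η f₁ f₂ f₃ g₁ g₂ g₃ h₁ h₂ h₃ : ℝ}
    (hn : 0 < n) (hN : N ≤ n) (hm : m ≤ b * n) (hb : 0 ≤ b) (hg : 0 ≤ g)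
    (hΓ : p.toReal * n ≤ Γ) (hδ : 0 < δ) (hf : δ ≤ f₁ + f₂)
    (hQ₁ : |f₁| ≤ Q) (hQ₃ : |f₃| ≤ Q) (hQg : |g₁| ≤ Q) (hη : 0 ≤ η) (hη1 : η ≤ 1)
    (hh₁ : h₁ = f₁ / (f₁ + f₂) * (1 + g ^ 2 * f₁ * f₃)) (hh₂ : h₂ = f₂ / (f₁ + f₂))
    (hh₃ : h₃ = f₁ / (f₁ + f₂) * (g * f₃))
    (hΔ₁ : |(g₁ - f₁) + h₁ / n| ≤ η / n) (hΔ₂ : |(g₂ - f₂) + h₂ / n| ≤ η / n)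
    (hΔ₃ : |(g₃ - f₃) + h₃ / n| ≤ η / n)
    (hκ : |p.toReal * n - g| * b ≤ η) (hκ2 : |(p.toReal * n) ^ 2 - g ^ 2| * b ≤ η)
    (hH₁ : |h₁| + 1 ≤ H) (hH₂ : |h₂| + 1 ≤ H) (hH₃ : |h₃| + 1 ≤ H)
    (hHΓ : 1 + Γ ^ 2 * b + Γ * b ≤ H) :
    meanSqDist N m K p.toReal (t + 1) n g₁ g₂ g₃ ≤
      (1 + (6 * driftLip δ Q g + 2) / n) * meanSqDist N m K p.toReal t n f₁ f₂ f₃ +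
        (6 * η + (9 * H ^ 2 + stepError (1 + Q) b Γ) / n) / n := by
  have hp0 : 0 ≤ p.toReal := ENNReal.toReal_nonneg
  have hp1 : p.toReal ≤ 1 := by
    have := ENNReal.toReal_mono ENNReal.one_ne_top hp
    simpa using this
  have hQ : 0 ≤ Q := (abs_nonneg _).trans hQ₁
  have hℓ := driftLip_nonneg hδ hQ hg
  have hκ0 : 0 ≤ p.toReal * n := mul_nonneg hp0 hn.le
  have hΓ0 : 0 ≤ Γ := hκ0.trans hΓ
  have hDelta : ∀ {a h : ℝ}, |a + h / n| ≤ η / n → |h| + 1 ≤ H → |a| ≤ H / n := by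
    intro a h h1 h2
    have e : a = (a + h / n) - h / n := by ring
    rw [e]
    refine (abs_sub _ _).trans ?_
    rw [abs_div h, abs_of_pos hn]
    refine (add_le_add h1 le_rfl).trans ?_
    rw [← add_div]
    exact div_le_div_of_nonneg_right (by linarith) hn.le
  have hD₁ := hDelta hΔ₁ hH₁
  have hD₂ := hDelta hΔ₂ hH₂
  have hD₃ := hDelta hΔ₃ hH₃
  -- The inequality holds for each state separately and is averaged over the law of the state
  -- afterwards.
  have hstate : ∀ E : State N m K,
      sqDist n g₁ g₂ g₃ E -
        2 / n * (E.uRIG.card / (E.uRIG.card + E.u0DRIG.card) *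
          ((E.uRIG.card / n - g₁) * (1 + E.uRIG.card * (E.wRIG.card * p.toReal ^ 2)) +
            (E.wRIG.card / n - g₃) * (E.wRIG.card * p.toReal)) +
          E.u0DRIG.card / (E.uRIG.card + E.u0DRIG.card) * (E.u0DRIG.card / n - g₂)) +
        stepError (1 + Q) b Γ / n ^ 2 ≤
      (1 + (6 * driftLip δ Q g + 2) / n) * sqDist n f₁ f₂ f₃ E +
        (6 * η + (9 * H ^ 2 + stepError (1 + Q) b Γ) / n) / n := by
    intro E
    obtain ⟨x₁, hx₁⟩ : ∃ x : ℝ, x = E.uRIG.card / n := ⟨_, rfl⟩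
    obtain ⟨x₂, hx₂⟩ : ∃ x : ℝ, x = E.u0DRIG.card / n := ⟨_, rfl⟩
    obtain ⟨x₃, hx₃⟩ : ∃ x : ℝ, x = E.wRIG.card / n := ⟨_, rfl⟩
    obtain ⟨κ, hκd⟩ : ∃ x : ℝ, x = p.toReal * n := ⟨_, rfl⟩
    have c1 : (E.uRIG.card : ℝ) = x₁ * n := by rw [hx₁, div_mul_cancel₀ _ hn.ne']
    have c2 : (E.u0DRIG.card : ℝ) = x₂ * n := by rw [hx₂, div_mul_cancel₀ _ hn.ne']
    have c3 : (E.wRIG.card : ℝ) = x₃ * n := by rw [hx₃, div_mul_cancel₀ _ hn.ne']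
    have cκ : p.toReal = κ / n := eq_div_of_mul_eq hn.ne' hκd.symm
    have hc1 : (E.uRIG.card : ℝ) ≤ N := by
      exact_mod_cast (Finset.card_le_univ _).trans_eq (Fintype.card_fin N)
    have hc3 : (E.wRIG.card : ℝ) ≤ m := by
      exact_mod_cast (Finset.card_le_univ _).trans_eq (Fintype.card_fin m)
    have b1 : 0 ≤ x₁ := by rw [hx₁]; exact div_nonneg (Nat.cast_nonneg _) hn.le
    have b1' : x₁ ≤ 1 := by rw [hx₁, div_le_one hn]; exact hc1.trans hN
    have b2 : 0 ≤ x₂ := by rw [hx₂]; exact div_nonneg (Nat.cast_nonneg _) hn.le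
    have b3 : 0 ≤ x₃ := by rw [hx₃]; exact div_nonneg (Nat.cast_nonneg _) hn.le
    have b3' : x₃ ≤ b := by rw [hx₃, div_le_iff₀ hn]; exact hc3.trans hm
    rw [← hκd] at hκ hκ2 hκ0 hΓ
    obtain ⟨k1, k2, k3⟩ := abs_drift_sub_le (κ := κ) b1 b1' b2 b3 b3' hδ hf hQ₁ hQ₃ hg
    rw [← hh₁] at k1
    rw [← hh₂] at k2
    rw [← hh₃] at k3
    obtain ⟨r0, r1⟩ := share_mem_Icc b1 b2
    obtain ⟨r0', r1'⟩ := share_mem_Icc b2 b1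
    rw [add_comm x₂ x₁] at r0' r1'
    have hΓb : 0 ≤ Γ ^ 2 * b := by positivity
    have hΓb' : 0 ≤ Γ * b := by positivity
    have hxx : κ ^ 2 * x₁ * x₃ ≤ Γ ^ 2 * b := by
      rw [mul_assoc]
      exact mul_le_mul (pow_le_pow_left₀ hκ0 hΓ 2) ((mul_le_of_le_one_left b3 b1').trans b3')
        (by positivity) (by positivity)
    have hx3 : κ * x₃ ≤ Γ * b := mul_le_mul hΓ b3' b3 hΓ0
    have hxx0 : 0 ≤ κ ^ 2 * x₁ * x₃ := by positivity
    have B1 : |x₁ / (x₁ + x₂) * (1 + κ ^ 2 * x₁ * x₃)| ≤ H := by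
      rw [abs_of_nonneg (by positivity)]
      exact (mul_le_of_le_one_left (by positivity) r1).trans (by linarith)
    have B2 : |x₂ / (x₁ + x₂)| ≤ H := by
      rw [abs_of_nonneg r0']; linarith
    have B3 : |x₁ / (x₁ + x₂) * (κ * x₃)| ≤ H := by
      rw [abs_of_nonneg (by positivity)]
      exact (mul_le_of_le_one_left (by positivity) r1).trans (by linarith)
    have main := sq_increments_le (d₁ := x₁ - f₁) (d₂ := x₂ - f₂) (d₃ := x₃ - f₃) hn hη
      hη1 hℓ hΔ₁ hΔ₂ hΔ₃ (k1.trans (by linarith)) (k2.trans (by linarith)) (k3.trans (by linarith)) hD₁ hD₂ hD₃ B1 B2 B3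
    have s1 : (E.uRIG.card : ℝ) / (E.uRIG.card + E.u0DRIG.card) = x₁ / (x₁ + x₂) := by
      rw [c1, c2, ← add_mul, mul_div_mul_right _ _ hn.ne']
    have s2 : (E.u0DRIG.card : ℝ) / (E.uRIG.card + E.u0DRIG.card) = x₂ / (x₁ + x₂) := by
      rw [c1, c2, ← add_mul, mul_div_mul_right _ _ hn.ne']
    have s3 : (E.uRIG.card : ℝ) * (E.wRIG.card * p.toReal ^ 2) = κ ^ 2 * x₁ * x₃ := by
      rw [c1, c3, cκ]; field_simp
    have s4 : (E.wRIG.card : ℝ) * p.toReal = κ * x₃ := by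
      rw [c3, cκ]; field_simp
    rw [s1, s2, s3, s4, sqDist, sqDist, ← hx₁, ← hx₂, ← hx₃]
    -- The target is the fluid point one iteration later, so the error is written as the current
    -- error minus the fluid increment.
    calc _ = (x₁ - f₁ - (g₁ - f₁)) ^ 2 + (x₂ - f₂ - (g₂ - f₂)) ^ 2 +
          (x₃ - f₃ - (g₃ - f₃)) ^ 2 -
          2 / n * ((x₁ - f₁ - (g₁ - f₁)) * (x₁ / (x₁ + x₂) * (1 + κ ^ 2 * x₁ * x₃)) +
            (x₂ - f₂ - (g₂ - f₂)) * (x₂ / (x₁ + x₂)) +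
            (x₃ - f₃ - (g₃ - f₃)) * (x₁ / (x₁ + x₂) * (κ * x₃))) +
          stepError (1 + Q) b Γ / n ^ 2 := by ring
      _ ≤ _ := add_le_add main le_rfl
      _ = _ := by ring
  have hstep : meanSqDist N m K p.toReal (t + 1) n g₁ g₂ g₃ ≤
      ∑ E : State N m K, ((1 + (6 * driftLip δ Q g + 2) / n) * sqDist n f₁ f₂ f₃ E +
        (6 * η + (9 * H ^ 2 + stepError (1 + Q) b Γ) / n) / n) *
          ∑ A, jointMass p.toReal t E A := by
    rw [meanSqDist, sum_jointMass_succ]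
    refine Finset.sum_le_sum fun E _ => ?_
    have hc1 : (E.uRIG.card : ℝ) ≤ N := by
      exact_mod_cast (Finset.card_le_univ _).trans_eq (Fintype.card_fin N)
    have hc3 : (E.wRIG.card : ℝ) ≤ m := by
      exact_mod_cast (Finset.card_le_univ _).trans_eq (Fintype.card_fin m)
    have hG : |E.uRIG.card / n - g₁| ≤ 1 + Q := by
      refine (abs_sub _ _).trans (add_le_add ?_ hQg)
      rw [abs_of_nonneg (by positivity), div_le_one hn]
      exact hc1.trans hN
    refine ((isBlockLaw_jointMass hp0 hp1 t E).sum_step_le (g₂ := g₂) (g₃ := g₃) hp0 hn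
      (hc1.trans hN) (hc3.trans hm) hΓ hb hG).trans ?_
    exact mul_le_mul_of_nonneg_right (hstate E)
      (Finset.sum_nonneg fun A _ => jointMass_nonneg hp0 hp1 t E A)
  refine hstep.trans_eq ?_
  simp only [add_mul _ _ (∑ A, jointMass p.toReal t _ A), Finset.sum_add_distrib]
  rw [← Finset.mul_sum (a := (6 * η + (9 * H ^ 2 + stepError (1 + Q) b Γ) / n) / n),
    sum_jointMass hp, mul_one, meanSqDist, Finset.mul_sum]
  congr 1
  exact Finset.sum_congr rfl fun E _ => by ring

/-! ### Asymptotics of the parameters -/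

section Parameters

variable {β γ c : ℝ}

theorem tendsto_nRIG_div (hβ : 0 < β) (hγ : 0 < γ) (hc : 0 < c) :
    Tendsto (fun M : ℕ => (nRIG β γ c M : ℝ) / M) atTop (𝓝 (sigma β γ c)) :=
  (tendsto_nat_floor_mul_div_atTop (sigma_pos hβ hγ hc).le).comp tendsto_natCast_atTop_atTop

theorem tendsto_nIso_div (c : ℝ) :
    Tendsto (fun M : ℕ => (nIso c M : ℝ) / M) atTop (𝓝 (Real.exp (-c))) :=
  (tendsto_nat_floor_mul_div_atTop (Real.exp_pos _).le).comp tendsto_natCast_atTop_atTop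

theorem tendsto_nTotal_div (hβ : 0 < β) (hγ : 0 < γ) (hc : 0 < c) :
    Tendsto (fun M : ℕ => (nTotal β γ c M : ℝ) / M) atTop
      (𝓝 (sigma β γ c + Real.exp (-c))) := by
  refine ((tendsto_nRIG_div hβ hγ hc).add (tendsto_nIso_div c)).congr fun M => ?_
  rw [nTotal, Nat.cast_add, add_div]

theorem tendsto_nRIG_atTop (hβ : 0 < β) (hγ : 0 < γ) (hc : 0 < c) :
    Tendsto (fun M : ℕ => (nRIG β γ c M : ℝ)) atTop atTop := by
  refine tendsto_natCast_atTop_atTop.comp (tendsto_nat_floor_atTop.comp ?_)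
  exact tendsto_natCast_atTop_atTop.const_mul_atTop (sigma_pos hβ hγ hc)

theorem nRIG_le_nTotal (β γ c : ℝ) (M : ℕ) : (nRIG β γ c M : ℝ) ≤ nTotal β γ c M := by
  exact_mod_cast Nat.le_add_right _ _

theorem tendsto_nTotal_atTop (hβ : 0 < β) (hγ : 0 < γ) (hc : 0 < c) :
    Tendsto (fun M : ℕ => (nTotal β γ c M : ℝ)) atTop atTop :=
  tendsto_atTop_mono (nRIG_le_nTotal β γ c) (tendsto_nRIG_atTop hβ hγ hc)

theorem tendsto_nRIG_div_nTotal (hβ : 0 < β) (hγ : 0 < γ) (hc : 0 < c) :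
    Tendsto (fun M : ℕ => (nRIG β γ c M : ℝ) / nTotal β γ c M) atTop
      (𝓝 (fracRIG β γ c)) := by
  have hs := add_pos (sigma_pos hβ hγ hc) (Real.exp_pos (-c))
  refine ((tendsto_nRIG_div hβ hγ hc).div (tendsto_nTotal_div hβ hγ hc) hs.ne').congr' ?_
  filter_upwards [eventually_gt_atTop 0] with M hM
  exact div_div_div_cancel_right₀ (Nat.cast_ne_zero.2 hM.ne') _ _

theorem tendsto_nIso_div_nTotal (hβ : 0 < β) (hγ : 0 < γ) (hc : 0 < c) :
    Tendsto (fun M : ℕ => (nIso c M : ℝ) / nTotal β γ c M) atTop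
      (𝓝 (Real.exp (-c) / (sigma β γ c + Real.exp (-c)))) := by
  have hs := add_pos (sigma_pos hβ hγ hc) (Real.exp_pos (-c))
  refine ((tendsto_nIso_div c).div (tendsto_nTotal_div hβ hγ hc) hs.ne').congr' ?_
  filter_upwards [eventually_gt_atTop 0] with M hM
  exact div_div_div_cancel_right₀ (Nat.cast_ne_zero.2 hM.ne') _ _

theorem tendsto_nAttr_div_nTotal (hβ : 0 < β) (hγ : 0 < γ) (hc : 0 < c) :
    Tendsto (fun M : ℕ => (nAttr β γ c M : ℝ) / nTotal β γ c M) atTop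
      (𝓝 (β * sigma β γ c / (sigma β γ c + Real.exp (-c)))) := by
  have h := ((tendsto_nat_floor_mul_div_atTop hβ.le).comp (tendsto_nRIG_atTop hβ hγ hc)).mul
    (tendsto_nRIG_div_nTotal hβ hγ hc)
  rw [fracRIG, ← mul_div_assoc] at h
  refine h.congr' ?_
  filter_upwards [(tendsto_nRIG_atTop hβ hγ hc).eventually_gt_atTop 0] with M hM
  exact div_mul_div_cancel₀ hM.ne'

/-- `γ / nRIG` rescaled by the total number of vertices tends to `γ / f`, which is where `γ̃` comes
from. -/
theorem tendsto_connProb_mul_nTotal (hβ : 0 < β) (hγ : 0 < γ) (hc : 0 < c) :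
    Tendsto (fun M : ℕ => (connProb β γ c M).toReal * nTotal β γ c M) atTop
      (𝓝 (gammaTilde β γ c)) := by
  have h := (tendsto_const_nhds (x := γ)).div (tendsto_nRIG_div_nTotal hβ hγ hc)
    (fracRIG_pos hβ hγ hc).ne'
  rw [← gammaTilde_eq] at h
  refine h.congr' ?_
  filter_upwards [(tendsto_nRIG_atTop hβ hγ hc).eventually_ge_atTop γ] with M hM
  have hpos : (0 : ℝ) < nRIG β γ c M := hγ.trans_le hM
  have h1 : ENNReal.ofReal (γ / nRIG β γ c M) ≤ 1 := by
    rw [ENNReal.ofReal_le_one, div_le_one hpos]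
    exact hM
  rw [connProb, min_eq_right h1, ENNReal.toReal_ofReal (by positivity)]
  simp only [Pi.div_apply, div_div_eq_mul_div]
  ring

theorem nAttr_le (hβ : 0 < β) (γ c : ℝ) (M : ℕ) :
    (nAttr β γ c M : ℝ) ≤ β * nTotal β γ c M := by
  refine (Nat.floor_le (by positivity)).trans ?_
  exact mul_le_mul_of_nonneg_left (nRIG_le_nTotal β γ c M) hβ.le

theorem connProb_le_one (β γ c : ℝ) (M : ℕ) : connProb β γ c M ≤ 1 := min_le_left _ _

theorem gammaTilde_pos (hβ : 0 < β) (hγ : 0 < γ) (hc : 0 < c) : 0 < gammaTilde β γ c := by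
  rw [gammaTilde_eq]
  exact div_pos hγ (fracRIG_pos hβ hγ hc)

/-! ### Convergence of the mean squared distance -/

/-- The mean squared distance, after `t` iterations, of the exploration to the fluid limit. -/
def fluidError (β γ c : ℝ) (F : FluidFunctions) (M t : ℕ) : ℝ :=
  meanSqDist (nRIG β γ c M) (nAttr β γ c M) (nIso c M) (connProb β γ c M).toReal t
    (nTotal β γ c M) (F.uRIG (t / nTotal β γ c M)) (F.u0DRIG (t / nTotal β γ c M))
    (F.wRIG (t / nTotal β γ c M))

theorem exists_abs_le_of_continuousOn {S : ℝ} {f : ℝ → ℝ} (hf : ContinuousOn f (Set.Icc 0 S)) :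
    ∃ C, ∀ s ∈ Set.Icc 0 S, |f s| ≤ C :=
  isCompact_Icc.exists_bound_of_continuousOn hf

theorem tendsto_fluidError_zero (hβ : 0 < β) (hγ : 0 < γ) (hc : 0 < c) {S : ℝ} (hS : 0 ≤ S)
    {F : FluidFunctions} (hF : IsFluidSolution β γ c S F) :
    Tendsto (fun M => fluidError β γ c F M 0) atTop (𝓝 0) := by
  have h0 : (0 : ℝ) ∈ Set.Icc 0 S := ⟨le_rfl, hS⟩
  have h1 : F.uRIG 0 = fracRIG β γ c := by simpa using hF.uRIG_eq 0 h0
  have h2 : F.u0DRIG 0 = Real.exp (-c) / (sigma β γ c + Real.exp (-c)) := by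
    simpa using hF.u0DRIG_eq 0 h0
  have h3 : F.wRIG 0 = β * sigma β γ c / (sigma β γ c + Real.exp (-c)) := by
    simpa using hF.wRIG_eq 0 h0
  have e : ∀ M, fluidError β γ c F M 0 =
      ((nRIG β γ c M : ℝ) / nTotal β γ c M - F.uRIG 0) ^ 2 +
        ((nIso c M : ℝ) / nTotal β γ c M - F.u0DRIG 0) ^ 2 +
        ((nAttr β γ c M : ℝ) / nTotal β γ c M - F.wRIG 0) ^ 2 := by
    intro M
    rw [fluidError, meanSqDist_zero (connProb_le_one β γ c M)]
    simp
  simp only [e, h1, h2, h3]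
  have t1 := ((tendsto_nRIG_div_nTotal hβ hγ hc).sub_const (fracRIG β γ c)).pow 2
  have t2 := ((tendsto_nIso_div_nTotal hβ hγ hc).sub_const
    (Real.exp (-c) / (sigma β γ c + Real.exp (-c)))).pow 2
  have t3 := ((tendsto_nAttr_div_nTotal hβ hγ hc).sub_const
    (β * sigma β γ c / (sigma β γ c + Real.exp (-c)))).pow 2
  simpa using (t1.add t2).add t3

theorem fluidError_nonneg (β γ c : ℝ) (F : FluidFunctions) (M t : ℕ) :
    0 ≤ fluidError β γ c F M t := by
  refine Finset.sum_nonneg fun E _ => ?_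
  rw [← stateLaw_toReal (connProb_le_one β γ c M)]
  refine mul_nonneg ENNReal.toReal_nonneg ?_
  unfold sqDist
  positivity

/-- Uniformity in `t` comes from Gronwall, whose constants depend on the solution only through
compactness of `[0, S]`. -/
theorem eventually_fluidError_le (hβ : 0 < β) (hγ : 0 < γ) (hc : 0 < c) {S : ℝ} (hS : 0 ≤ S)
    {F : FluidFunctions} (hF : IsFluidSolution β γ c S F) {ε : ℝ} (hε : 0 < ε) :
    ∀ᶠ M : ℕ in atTop, ∀ t : ℕ, t ≤ S * nTotal β γ c M → fluidError β γ c F M t ≤ ε := by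
  have hg := gammaTilde_pos hβ hγ hc
  have hratio : ContinuousOn F.probRIG (Set.Icc 0 S) :=
    hF.continuousOn_uRIG.div (hF.continuousOn_uRIG.add hF.continuousOn_u0DRIG)
      fun s hs => (hF.pos s hs).ne'
  have hc₂ : ContinuousOn F.probDRIG (Set.Icc 0 S) :=
    hF.continuousOn_u0DRIG.div (hF.continuousOn_uRIG.add hF.continuousOn_u0DRIG)
      fun s hs => (hF.pos s hs).ne'
  have hc₁ : ContinuousOn (fun y => F.probRIG y *
      (1 + gammaTilde β γ c ^ 2 * F.uRIG y * F.wRIG y)) (Set.Icc 0 S) :=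
    hratio.mul (continuousOn_const.add
      ((continuousOn_const.mul hF.continuousOn_uRIG).mul hF.continuousOn_wRIG))
  have hc₃ : ContinuousOn (fun y => F.probRIG y * (gammaTilde β γ c * F.wRIG y))
      (Set.Icc 0 S) := hratio.mul (continuousOn_const.mul hF.continuousOn_wRIG)
  obtain ⟨Q₁, hQ₁⟩ := exists_abs_le_of_continuousOn hF.continuousOn_uRIG
  obtain ⟨Q₃, hQ₃⟩ := exists_abs_le_of_continuousOn hF.continuousOn_wRIG
  obtain ⟨H₁, hH₁⟩ := exists_abs_le_of_continuousOn hc₁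
  obtain ⟨H₂, hH₂⟩ := exists_abs_le_of_continuousOn hc₂
  obtain ⟨H₃, hH₃⟩ := exists_abs_le_of_continuousOn hc₃
  have h0 : (0 : ℝ) ∈ Set.Icc 0 S := ⟨le_rfl, hS⟩
  obtain ⟨s₀, hs₀, hmin⟩ := isCompact_Icc.exists_isMinOn ⟨0, h0⟩
    (hF.continuousOn_uRIG.add hF.continuousOn_u0DRIG)
  set δ := F.uRIG s₀ + F.u0DRIG s₀ with hδd
  have hδ : 0 < δ := hF.pos s₀ hs₀
  set g := gammaTilde β γ c with hgd
  set Q := max Q₁ Q₃ with hQd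
  -- An eventual upper bound for `p * n`, which tends to `g`.
  set Γ := g + 1 with hΓd
  set H := max (max (H₁ + 1) (H₂ + 1)) (max (H₃ + 1) (1 + Γ ^ 2 * β + Γ * β)) with hHd
  set L := 6 * driftLip δ Q g + 2 with hLd
  have hQ0 : 0 ≤ Q := (abs_nonneg _).trans ((hQ₁ 0 h0).trans (le_max_left _ _))
  have hL : 0 ≤ L := by
    have := driftLip_nonneg hδ hQ0 hg.le
    linarith
  have hden : 0 < 7 * (Real.exp (L * S) * (1 + S)) := by positivity
  -- The factor `7` counts the six `η` of the recursion and one more that absorbs the terms of order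
  -- `1 / n`; the initial error is also taken below `η`.
  obtain ⟨η, hηd⟩ : ∃ η, η = min 1 (ε / (7 * (Real.exp (L * S) * (1 + S)))) := ⟨_, rfl⟩
  have hη : 0 < η := by rw [hηd]; exact lt_min one_pos (div_pos hε hden)
  have hη1 : η ≤ 1 := by rw [hηd]; exact min_le_left _ _
  have hηε : Real.exp (L * S) * (η + 7 * η * S) ≤ ε := by
    have h1 : η ≤ ε / (7 * (Real.exp (L * S) * (1 + S))) := by rw [hηd]; exact min_le_right _ _
    rw [le_div_iff₀ hden] at h1
    refine le_trans ?_ h1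
    have : η + 7 * η * S ≤ 7 * η * (1 + S) := by nlinarith
    refine (mul_le_mul_of_nonneg_left this (Real.exp_pos _).le).trans_eq (by ring)
  obtain ⟨δ₁, hδ₁, hE₁⟩ := exists_uniform_expansion hc₁ hF.uRIG_eq hη
  obtain ⟨δ₂, hδ₂, hE₂⟩ := exists_uniform_expansion hc₂ hF.u0DRIG_eq hη
  obtain ⟨δ₃, hδ₃, hE₃⟩ := exists_uniform_expansion hc₃ hF.wRIG_eq hη
  have hn := tendsto_nTotal_atTop hβ hγ hc
  have hκ := tendsto_connProb_mul_nTotal hβ hγ hc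
  rw [← hgd] at hκ
  have hκ1 : Tendsto (fun M : ℕ => |(connProb β γ c M).toReal * nTotal β γ c M - g| * β)
      atTop (𝓝 0) := by
    simpa using (hκ.sub_const g).abs.mul_const β
  have hκ2 : Tendsto (fun M : ℕ =>
      |((connProb β γ c M).toReal * nTotal β γ c M) ^ 2 - g ^ 2| * β) atTop (𝓝 0) := by
    have := ((hκ.pow 2).sub_const (g ^ 2)).abs.mul_const β
    rwa [sub_self, abs_zero, zero_mul] at this
  have hinv : Tendsto (fun M : ℕ => (1 : ℝ) / nTotal β γ c M) atTop (𝓝 0) :=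
    hn.const_div_atTop 1
  have hsec : Tendsto (fun M : ℕ => (9 * H ^ 2 + stepError (1 + Q) β Γ) / nTotal β γ c M)
      atTop (𝓝 0) := hn.const_div_atTop _
  filter_upwards [hn.eventually_gt_atTop 0, hκ.eventually_lt_const (lt_add_one g),
    hκ1.eventually_lt_const hη, hκ2.eventually_lt_const hη,
    hinv.eventually_lt_const hδ₁, hinv.eventually_lt_const hδ₂, hinv.eventually_lt_const hδ₃,
    hsec.eventually_lt_const hη,
    (tendsto_fluidError_zero hβ hγ hc hS hF).eventually_lt_const hη] with
    M hn0 hΓM hκ1M hκ2M hd1 hd2 hd3 hsecM h0M t ht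
  set n : ℝ := (nTotal β γ c M : ℝ) with hnd
  refine (discrete_gronwall (a := fluidError β γ c F M) (ε := 7 * η) (T := t) hn0 hL
    (by positivity) ht (fluidError_nonneg β γ c F M 0) (fun r hr => ?_) t le_rfl).trans ?_
  · have hrS : (r : ℝ) / n ∈ Set.Icc 0 S := by
      refine ⟨by positivity, ?_⟩
      rw [div_le_iff₀ hn0]
      exact (Nat.cast_le.2 hr.le).trans ht
    have hrS' : ((r + 1 : ℕ) : ℝ) / n ∈ Set.Icc 0 S := by
      refine ⟨by positivity, ?_⟩
      rw [div_le_iff₀ hn0]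
      exact (Nat.cast_le.2 hr).trans ht
    have hdiff : ((r + 1 : ℕ) : ℝ) / n - r / n = 1 / n := by
      push_cast; ring
    have hle : (r : ℝ) / n ≤ ((r + 1 : ℕ) : ℝ) / n := by
      rw [← sub_nonneg, hdiff]; positivity
    have e1 := hE₁ _ hrS _ hrS' hle (by rw [hdiff]; exact hd1.le)
    have e2 := hE₂ _ hrS _ hrS' hle (by rw [hdiff]; exact hd2.le)
    have e3 := hE₃ _ hrS _ hrS' hle (by rw [hdiff]; exact hd3.le)
    rw [hdiff, mul_one_div, mul_one_div] at e1 e2 e3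
    have hHa : ∀ {x : ℝ}, x ≤ H₁ → x + 1 ≤ H := fun hx =>
      (add_le_add hx le_rfl).trans ((le_max_left _ _).trans (le_max_left _ _))
    have hHb : ∀ {x : ℝ}, x ≤ H₂ → x + 1 ≤ H := fun hx =>
      (add_le_add hx le_rfl).trans ((le_max_right _ _).trans (le_max_left _ _))
    have hHc : ∀ {x : ℝ}, x ≤ H₃ → x + 1 ≤ H := fun hx =>
      (add_le_add hx le_rfl).trans ((le_max_left _ _).trans (le_max_right _ _))
    have hstep := meanSqDist_succ_le (N := nRIG β γ c M) (m := nAttr β γ c M) (K := nIso c M)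
      (connProb_le_one β γ c M) r hn0 (nRIG_le_nTotal β γ c M) (nAttr_le hβ γ c M) hβ.le hg.le
      hΓM.le hδ (hmin hrS) ((hQ₁ _ hrS).trans (le_max_left _ _))
      ((hQ₃ _ hrS).trans (le_max_right _ _)) ((hQ₁ _ hrS').trans (le_max_left _ _)) hη.le hη1
      rfl rfl rfl e1 e2 e3 hκ1M.le hκ2M.le (hHa (hH₁ _ hrS)) (hHb (hH₂ _ hrS))
      (hHc (hH₃ _ hrS)) ((le_max_right _ _).trans (le_max_right _ _))
    refine hstep.trans (add_le_add le_rfl (div_le_div_of_nonneg_right ?_ hn0.le))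
    linarith
  · refine le_trans (mul_le_mul_of_nonneg_left ?_ (Real.exp_pos _).le) hηε
    linarith

theorem tendsto_fluidError (hβ : 0 < β) (hγ : 0 < γ) (hc : 0 < c) {S : ℝ}
    {F : FluidFunctions} (hF : IsFluidSolution β γ c S F) {s : ℝ} (hs : s ∈ Set.Icc 0 S) :
    Tendsto (fun M => fluidError β γ c F M ⌊s * nTotal β γ c M⌋₊) atTop (𝓝 0) := by
  have hS := hs.1.trans hs.2
  rw [Metric.tendsto_nhds]
  intro ε hε
  filter_upwards [eventually_fluidError_le hβ hγ hc hS hF (half_pos hε)] with M hM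
  rw [Real.dist_eq, sub_zero, abs_of_nonneg (fluidError_nonneg β γ c F M _)]
  refine (hM _ ?_).trans_lt (half_lt_self hε)
  refine (Nat.floor_le (mul_nonneg hs.1 (Nat.cast_nonneg _))).trans ?_
  exact mul_le_mul_of_nonneg_right hs.2 (Nat.cast_nonneg _)

/-! ### Uniform convergence in probability -/

theorem explorationProb_state {M t : ℕ} (ht : t ≤ nTotal β γ c M)
    (s : Set (State (nRIG β γ c M) (nAttr β γ c M) (nIso c M))) :
    explorationProb β γ c M {ω | ω t ∈ s} =
      (stateLaw (nRIG β γ c M) (nAttr β γ c M) (nIso c M) (connProb β γ c M)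
        (connProb_le_one β γ c M) t).toOuterMeasure s := by
  have h : (explorationPMF β γ c M).map (fun ω => ω t) =
      stateLaw (nRIG β γ c M) (nAttr β γ c M) (nIso c M) (connProb β γ c M)
        (connProb_le_one β γ c M) t := by
    rw [explorationPMF, PMF.map_bind, stateLaw]
    congr 1
    funext A
    exact trajectoryPMF_map A ht
  rw [← h, PMF.toOuterMeasure_map_apply]
  rfl

/-- Inclusion is required only on reachable trajectories, so that pathwise invariants may be used.
-/
theorem explorationProb_mono {M : ℕ} {s t : Set (Path β γ c M)}
    (h : ∀ A, ∀ ω ∈ (trajectoryPMF A (nTotal β γ c M)).support, ω ∈ s → ω ∈ t) :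
    explorationProb β γ c M s ≤ explorationProb β γ c M t := by
  refine PMF.toOuterMeasure_mono _ ?_
  rintro ω ⟨hs, hω⟩
  rw [explorationPMF, PMF.mem_support_bind_iff] at hω
  obtain ⟨A, _, hA⟩ := hω
  exact h A ω hA hs

/-- The scaled number of unaffected vertices converges at a fixed time. -/
theorem tendsto_prob_unaffected_at (hβ : 0 < β) (hγ : 0 < γ) (hc : 0 < c) {S : ℝ} (hS1 : S ≤ 1)
    {F : FluidFunctions} (hF : IsFluidSolution β γ c S F) {s : ℝ} (hs : s ∈ Set.Icc 0 S)
    {η : ℝ} (hη : 0 < η) :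
    Tendsto (fun M : ℕ => explorationProb β γ c M {ω | η < |scaledUnaffected β γ c M ω s -
      (F.uRIG (⌊s * nTotal β γ c M⌋₊ / nTotal β γ c M) +
        F.u0DRIG (⌊s * nTotal β γ c M⌋₊ / nTotal β γ c M))|}) atTop (𝓝 0) := by
  have h1 : Tendsto (fun M : ℕ => ENNReal.ofReal
      (2 / η ^ 2 * fluidError β γ c F M ⌊s * nTotal β γ c M⌋₊)) atTop (𝓝 0) := by
    have := (tendsto_fluidError hβ hγ hc hF hs).const_mul (2 / η ^ 2)
    rw [mul_zero] at this
    simpa using ENNReal.tendsto_ofReal this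
  refine tendsto_of_tendsto_of_tendsto_of_le_of_le tendsto_const_nhds h1
    (fun M => zero_le) fun M => ?_
  have ht : ⌊s * nTotal β γ c M⌋₊ ≤ nTotal β γ c M := by
    refine Nat.floor_le_of_le ?_
    exact mul_le_of_le_one_left (Nat.cast_nonneg _) (hs.2.trans hS1)
  exact (explorationProb_state ht _).trans_le (stateLaw_deviation_le _ _ _ _ _ _ hη)

/-- The scaled number of unaffected vertices converges uniformly. -/
theorem tendsto_prob_unaffected (hβ : 0 < β) (hγ : 0 < γ) (hc : 0 < c) {S : ℝ} (hS : 0 ≤ S)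
    (hS1 : S ≤ 1) {F : FluidFunctions} (hF : IsFluidSolution β γ c S F) {ε : ℝ} (hε : 0 < ε) :
    Tendsto (fun M : ℕ => explorationProb β γ c M {ω | ∃ s ∈ Set.Icc 0 S,
      ε < |scaledUnaffected β γ c M ω s - (F.uRIG s + F.u0DRIG s)|}) atTop (𝓝 0) := by
  set G : ℝ → ℝ := fun s => F.uRIG s + F.u0DRIG s with hG
  have hGc : ContinuousOn G (Set.Icc 0 S) := hF.continuousOn_uRIG.add hF.continuousOn_u0DRIG
  obtain ⟨δ, hδ, hosc⟩ := Metric.uniformContinuousOn_iff_le.1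
    (isCompact_Icc.uniformContinuousOn_of_continuous hGc) (ε / 4) (by positivity)
  -- Truncation at `S` keeps the grid in the interval and makes `S` its last point; the `+ 2` in `J`
  -- provides a right neighbour for every `s`.
  let grid : ℕ → ℝ := fun i => min (i * δ) S
  have hgrid : ∀ i, grid i ∈ Set.Icc 0 S := fun i =>
    ⟨le_min (by positivity) hS, min_le_right _ _⟩
  let J := ⌊S / δ⌋₊ + 2
  let bad : (M : ℕ) → ℕ → Set (Path β γ c M) := fun M i =>
    {ω | ε / 4 < |scaledUnaffected β γ c M ω (grid i) -
      (F.uRIG (⌊grid i * nTotal β γ c M⌋₊ / nTotal β γ c M) +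
        F.u0DRIG (⌊grid i * nTotal β γ c M⌋₊ / nTotal β γ c M))|}
  have hsum : Tendsto (fun M : ℕ => ∑ i ∈ Finset.range J, explorationProb β γ c M (bad M i))
      atTop (𝓝 0) := by
    have := tendsto_finsetSum (Finset.range J) fun i _ =>
      tendsto_prob_unaffected_at hβ hγ hc hS1 hF (hgrid i) (by positivity : 0 < ε / 4)
    simpa using this
  refine tendsto_of_tendsto_of_tendsto_of_le_of_le' tendsto_const_nhds hsum
    (Eventually.of_forall fun M => zero_le) ?_
  have hn := tendsto_nTotal_atTop hβ hγ hc
  have hinv : Tendsto (fun M : ℕ => (1 : ℝ) / nTotal β γ c M) atTop (𝓝 0) :=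
    hn.const_div_atTop 1
  filter_upwards [hn.eventually_gt_atTop 0, hinv.eventually_lt_const hδ] with M hn0 hnδ
  set n : ℝ := (nTotal β γ c M : ℝ) with hnd
  have hsub : explorationProb β γ c M {ω | ∃ s ∈ Set.Icc 0 S,
      ε < |scaledUnaffected β γ c M ω s - (F.uRIG s + F.u0DRIG s)|} ≤
        explorationProb β γ c M (⋃ i ∈ Finset.range J, bad M i) := by
    refine explorationProb_mono fun A ω hω hbad => ?_
    by_contra hgood
    simp only [Set.mem_iUnion, not_exists] at hgood
    -- Error budget: `ε / 4` for the deviation and `ε / 4` for rounding the time at grid points,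
    -- then `ε / 4` for the oscillation of the fluid limit between them.
    have hpt : ∀ i ∈ Finset.range J,
        |scaledUnaffected β γ c M ω (grid i) - G (grid i)| ≤ ε / 2 := by
      intro i hi
      have h1 : |scaledUnaffected β γ c M ω (grid i) - G (⌊grid i * n⌋₊ / n)| ≤ ε / 4 :=
        le_of_not_gt (hgood i hi)
      have hfl : (⌊grid i * n⌋₊ : ℝ) / n ∈ Set.Icc 0 S := by
        refine ⟨by positivity, ?_⟩
        rw [div_le_iff₀ hn0]
        exact (Nat.floor_le (mul_nonneg (hgrid i).1 hn0.le)).trans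
          (mul_le_mul_of_nonneg_right (hgrid i).2 hn0.le)
      have hfd : |(⌊grid i * n⌋₊ : ℝ) / n - grid i| ≤ δ := by
        have h2 := Nat.floor_le (mul_nonneg (hgrid i).1 hn0.le)
        have h3 := (Nat.lt_floor_add_one (grid i * n)).le
        have e : (⌊grid i * n⌋₊ : ℝ) / n - grid i = (⌊grid i * n⌋₊ - grid i * n) / n := by
          field_simp
        rw [e, abs_div, abs_of_pos hn0]
        refine (div_le_div_of_nonneg_right ?_ hn0.le).trans hnδ.le
        rw [abs_le]
        constructor <;> linarith
      have h4 := hosc _ hfl _ (hgrid i) hfd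
      rw [Real.dist_eq] at h4
      refine (abs_sub_le _ (G (⌊grid i * n⌋₊ / n)) _).trans ?_
      linarith
    obtain ⟨s, hs, hlt⟩ := hbad
    set i := ⌊s / δ⌋₊ with hi
    have hi1 : (i : ℝ) * δ ≤ s := by
      rw [← le_div_iff₀ hδ]; exact Nat.floor_le (div_nonneg hs.1 hδ.le)
    have hi2 : s ≤ ((i + 1 : ℕ) : ℝ) * δ := by
      rw [← div_le_iff₀ hδ]; push_cast; exact (Nat.lt_floor_add_one _).le
    have hiJ : i ≤ ⌊S / δ⌋₊ := Nat.floor_le_floor (div_le_div_of_nonneg_right hs.2 hδ.le)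
    have hgi : grid i = i * δ := min_eq_left (hi1.trans hs.2)
    have hl : grid i ≤ s := by rw [hgi]; exact hi1
    have hr : s ≤ grid (i + 1) := le_min hi2 hs.2
    have hlr : grid (i + 1) ≤ grid i + δ := by
      rw [hgi]
      refine (min_le_left _ _).trans_eq ?_
      push_cast; ring
    -- The process decreases along the trajectory, so its value at `s` is squeezed between the
    -- values at adjacent grid points.
    have hmono : ∀ {a b : ℝ}, a ≤ b → b ≤ S →
        scaledUnaffected β γ c M ω b ≤ scaledUnaffected β γ c M ω a := by
      intro a b hab hb
      refine div_le_div_of_nonneg_right (Nat.cast_le.2 ?_) hn0.le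
      refine numUnaffected_antitone hω
        (Nat.floor_le_floor (mul_le_mul_of_nonneg_right hab hn0.le)) (Nat.floor_le_of_le ?_)
      exact mul_le_of_le_one_left hn0.le (hb.trans hS1)
    have p1 := hpt i (Finset.mem_range.2 (by omega))
    have p2 := hpt (i + 1) (Finset.mem_range.2 (by omega))
    have o1 := hosc _ hs _ (hgrid i) (by
      rw [Real.dist_eq, abs_of_nonneg (by linarith)]; linarith)
    have o2 := hosc _ hs _ (hgrid (i + 1)) (by
      rw [Real.dist_eq, abs_sub_comm, abs_of_nonneg (by linarith)]; linarith)
    rw [Real.dist_eq, abs_le] at o1 o2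
    rw [abs_le] at p1 p2
    have m1 := hmono hl hs.2
    have m2 := hmono hr (hgrid (i + 1)).2
    refine absurd hlt (not_lt.2 (abs_le.2 ⟨?_, ?_⟩))
    · have : F.uRIG s + F.u0DRIG s = G s := rfl
      linarith
    · have : F.uRIG s + F.u0DRIG s = G s := rfl
      linarith
  refine hsub.trans ?_
  exact MeasureTheory.measure_biUnion_finset_le _ _

/-- The fluid limit of the scaled number of excited vertices is the identity. -/
theorem IsFluidSolution.excited_eq {S : ℝ} {F : FluidFunctions}
    (hF : IsFluidSolution β γ c S F) {s : ℝ} (hs : s ∈ Set.Icc 0 S) :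
    F.x0RIG s + F.x1RIG s + F.x0DRIG s = s := by
  have hsub : Set.uIcc 0 s ⊆ Set.Icc 0 S := Set.uIcc_subset_Icc ⟨le_rfl, hs.1.trans hs.2⟩ hs
  have hsum : ContinuousOn (fun y => F.uRIG y + F.u0DRIG y) (Set.Icc 0 S) :=
    hF.continuousOn_uRIG.add hF.continuousOn_u0DRIG
  have hne : ∀ y ∈ Set.Icc 0 S, F.uRIG y + F.u0DRIG y ≠ 0 := fun y hy => (hF.pos y hy).ne'
  have hr : ContinuousOn F.probRIG (Set.Icc 0 S) := hF.continuousOn_uRIG.div hsum hne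
  have hd : ContinuousOn F.probDRIG (Set.Icc 0 S) := hF.continuousOn_u0DRIG.div hsum hne
  have hq : ContinuousOn (F.probIso β γ c) (Set.Icc 0 S) := by
    have h1 := hF.continuousOn_wRIG
    have h2 := hF.continuousOn_x0RIG
    have h3 := hF.continuousOn_x1RIG
    unfold FluidFunctions.probIso
    fun_prop
  have i1 : IntervalIntegrable (fun y => F.probRIG y * F.probIso β γ c y)
      MeasureTheory.volume 0 s := ((hr.mul hq).mono hsub).intervalIntegrable
  have i2 : IntervalIntegrable (fun y => F.probRIG y * (1 - F.probIso β γ c y))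
      MeasureTheory.volume 0 s :=
    ((hr.mul (continuousOn_const.sub hq)).mono hsub).intervalIntegrable
  have i3 : IntervalIntegrable F.probDRIG MeasureTheory.volume 0 s :=
    (hd.mono hsub).intervalIntegrable
  rw [hF.x0RIG_eq s hs, hF.x1RIG_eq s hs, hF.x0DRIG_eq s hs,
    ← intervalIntegral.integral_add i1 i2, ← intervalIntegral.integral_add (i1.add i2) i3]
  -- The probability of having no neighbours cancels and the two shares add up to one.
  have : ∫ y in (0 : ℝ)..s, (F.probRIG y * F.probIso β γ c y +
      F.probRIG y * (1 - F.probIso β γ c y) + F.probDRIG y) = ∫ _ in (0 : ℝ)..s, (1 : ℝ) := by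
    refine intervalIntegral.integral_congr fun y hy => ?_
    have := hne y (hsub hy)
    simp only [FluidFunctions.probRIG, FluidFunctions.probDRIG]
    field_simp
    ring
  rw [this]
  simp

/-- The scaled number of excited vertices converges uniformly. -/
theorem tendsto_prob_excited (hβ : 0 < β) (hγ : 0 < γ) (hc : 0 < c) {S : ℝ} (hS : 0 ≤ S)
    (hS1 : S ≤ 1) {F : FluidFunctions} (hF : IsFluidSolution β γ c S F) {ε : ℝ} (hε : 0 < ε) :
    Tendsto (fun M : ℕ => explorationProb β γ c M {ω | ∃ s ∈ Set.Icc 0 S,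
      ε < |scaledExcited β γ c M ω s - (F.x0RIG s + F.x1RIG s + F.x0DRIG s)|})
      atTop (𝓝 0) := by
  obtain ⟨s₀, hs₀, hmin⟩ := isCompact_Icc.exists_isMinOn ⟨0, ⟨le_rfl, hS⟩⟩
    (hF.continuousOn_uRIG.add hF.continuousOn_u0DRIG)
  have hδ := hF.pos s₀ hs₀
  set δ := F.uRIG s₀ + F.u0DRIG s₀ with hδd
  refine tendsto_of_tendsto_of_tendsto_of_le_of_le' tendsto_const_nhds
    -- `δ` is the minimum of the fluid limit of unaffected vertices on `[0, S]`. A deviation of at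
    -- most `δ / 2` leaves unaffected vertices, whence `X` equals the number of iterations and
    -- differs from `s * n` by rounding only.
    (tendsto_prob_unaffected hβ hγ hc hS hS1 hF (half_pos hδ))
    (Eventually.of_forall fun M => zero_le) ?_
  have hn := tendsto_nTotal_atTop hβ hγ hc
  have hinv : Tendsto (fun M : ℕ => (1 : ℝ) / nTotal β γ c M) atTop (𝓝 0) :=
    hn.const_div_atTop 1
  filter_upwards [hn.eventually_gt_atTop 0, hinv.eventually_lt_const hε] with M hn0 hnε
  refine explorationProb_mono fun A ω hω hbad => ?_
  obtain ⟨s, hs, hlt⟩ := hbad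
  refine ⟨s, hs, ?_⟩
  by_contra hgood
  have h1 := (abs_le.1 (not_lt.1 hgood)).1
  have h2 : δ ≤ F.uRIG s + F.u0DRIG s := hmin hs
  have hpos : 0 < scaledUnaffected β γ c M ω s := by linarith
  set n : ℝ := (nTotal β γ c M : ℝ) with hnd
  have hnum : 0 < (ω ⌊s * n⌋₊).numUnaffected := by
    rw [scaledUnaffected, div_pos_iff_of_pos_right hn0] at hpos
    exact_mod_cast hpos
  have hfl : ⌊s * n⌋₊ ≤ nTotal β γ c M :=
    Nat.floor_le_of_le (mul_le_of_le_one_left hn0.le (hs.2.trans hS1))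
  have hex : (ω ⌊s * n⌋₊).numExcited = ⌊s * n⌋₊ :=
    ((isInvariant_numExcited A).trajectory hω hfl).2.2.2 hnum
  rw [hF.excited_eq hs, scaledExcited, hex, ← hnd] at hlt
  have h3 := Nat.floor_le (mul_nonneg hs.1 hn0.le)
  have h4 := (Nat.lt_floor_add_one (s * n)).le
  have e : (⌊s * n⌋₊ : ℝ) / n - s = (⌊s * n⌋₊ - s * n) / n := by field_simp
  rw [e, abs_div, abs_of_pos hn0] at hlt
  have h5 : |(⌊s * n⌋₊ : ℝ) - s * n| / n ≤ 1 / n := by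
    refine div_le_div_of_nonneg_right ?_ hn0.le
    rw [abs_le]
    constructor <;> linarith
  linarith

/-- If every value is at most `ε`, so is the supremum. This needs only a nonempty index set;
boundedness of the family is not required in this direction. -/
theorem explorationProb_iSup_le {M : ℕ} {S ε : ℝ} (hS : 0 ≤ S)
    (f : Path β γ c M → ℝ → ℝ) :
    explorationProb β γ c M {ω | ε < ⨆ s : Set.Icc (0 : ℝ) S, f ω s} ≤
      explorationProb β γ c M {ω | ∃ s ∈ Set.Icc 0 S, ε < f ω s} := by
  refine explorationProb_mono fun A ω _ hω => ?_
  by_contra h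
  have hne : Nonempty (Set.Icc (0 : ℝ) S) := ⟨⟨0, le_rfl, hS⟩⟩
  have hω' : ε < ⨆ s : Set.Icc (0 : ℝ) S, f ω s := hω
  refine absurd hω' (not_lt.2 (ciSup_le fun s => ?_))
  by_contra h'
  exact h ⟨s, s.2, not_le.1 h'⟩

end Parameters

end MixtureExploration

end

open MixtureExploration Filter Topology in
theorem theorem2 (β γ c : ℝ) (hβ : 0 < β) (hγ : 0 < γ) (hc : 0 < c) :
    -- the range of times is nontrivial
    (0 < jammingFraction β γ c ∧ jammingFraction β γ c ≤ 1) ∧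
    -- the system of integral equations has a solution on all of `[0, φ)`
    (∃ F : FluidFunctions, ∀ S : ℝ, 0 ≤ S → S < jammingFraction β γ c →
      IsFluidSolution β γ c S F) ∧
    -- the scaled processes converge uniformly on `[0, S]` in probability to the solution
    (∀ S : ℝ, 0 ≤ S → S < jammingFraction β γ c →
      ∀ F : FluidFunctions, IsFluidSolution β γ c S F → ∀ ε : ℝ, 0 < ε →
        Tendsto (fun M : ℕ => explorationProb β γ c M
          {ω | ε < ⨆ s : Set.Icc (0 : ℝ) S,
            |scaledUnaffected β γ c M ω s - (F.uRIG s + F.u0DRIG s)|}) atTop (𝓝 0) ∧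
        Tendsto (fun M : ℕ => explorationProb β γ c M
          {ω | ε < ⨆ s : Set.Icc (0 : ℝ) S,
            |scaledExcited β γ c M ω s - (F.x0RIG s + F.x1RIG s + F.x0DRIG s)|})
          atTop (𝓝 0)) := by
  have hφ := jammingFraction_le_one hβ hγ hc
  refine ⟨⟨jammingFraction_pos hβ hγ hc, hφ⟩, exists_isFluidSolution hβ hγ hc, ?_⟩
  intro S hS hSφ F hF ε hε
  -- The convergence uses `S < φ` only here: times up to `S` then lie within the `n` recorded
  -- iterations. Positivity of the denominator is part of `IsFluidSolution`.
  have hS1 : S ≤ 1 := hSφ.le.trans hφ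
  exact ⟨tendsto_of_tendsto_of_tendsto_of_le_of_le tendsto_const_nhds
      (tendsto_prob_unaffected hβ hγ hc hS hS1 hF hε) (fun _ => zero_le)
      fun M => explorationProb_iSup_le hS fun ω s =>
        |scaledUnaffected β γ c M ω s - (F.uRIG s + F.u0DRIG s)|,
    tendsto_of_tendsto_of_tendsto_of_le_of_le tendsto_const_nhds
      (tendsto_prob_excited hβ hγ hc hS hS1 hF hε) (fun _ => zero_le)
      fun M => explorationProb_iSup_le hS fun ω s =>
        |scaledExcited β γ c M ω s - (F.x0RIG s + F.x1RIG s + F.x0DRIG s)|⟩
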